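/- For finitely generated groups $G,H$ write $G\preccurlyeq H$ ("$G$ preforms $H$") if there are a finite generating set $T$ of $H$ and a sequence $S_1,S_2,\dots$ of finite generating sets of $G$, with bijections $T\to S_n$, such that for every $R\in\mathbb N$ and all sufficiently large $n$ the balls of radius $R$ around the identity in the marked Cayley graphs of $(G,S_n)$ and $(H,T)$ are isomorphic. Consider the graph whose vertices are the isomorphism classes of finitely generated groups, two distinct vertices being joined if one of them preforms the other; "connected component" refers to this unoriented graph. The variety generated by a group is the set of identities that it satisfies, i.e. of words $w$ in the free group on $x_1,x_2,\dots$ with $w(g_1,g_2,\dots)=1$ for all elements $g_i$ of the group. For a set $W$ of words, the verbal subgroup $W(H)$ of a group $H$ is the subgroup generated by all values $w(h_1,h_2,\dots)$ with $w\in W$ and $h_i\in H$. Let $G$ be a finitely generated nilpotent group, let $\mathcal V$ be the variety that it generates, and let $\mathrm{Torsion}(G)$ be the subgroup of elements of finite order of $G$. 1. The connected component of $G$ coincides with the set of (isomorphism classes of) finitely generated groups generating $\mathcal V$ if and only if $G/\mathrm{Torsion}(G)$ generates $\mathcal V$. 2. If $G/\mathrm{Torsion}(G)$ does not generate $\mathcal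 V$, then the set of finitely generated groups generating $\mathcal V$ is the union of infinitely many connected components. Moreover, there is a set $W$ of words such that $W(G)$ is finite and non-trivial and such that: for every $n\ge 1$ the power $G^n$ generates $\mathcal V$, the group $W(G^n)$ is finite, and every finitely generated group $H$ in the connected component of $G^n$ has $W(H)$ finite with $\#W(H)=\#W(G^n)$; and for $m\ne n$, $m,n\ge1$, one has $\#W(G^m)\ne\#W(G^n)$, so that $G^m$ and $G^n$ lie in distinct connected components. -/

import Mathlib

universe u

open scoped commutatorElement

/-! ### Marked Cayley graphs and the relation of preforming -/

/-- The set of elements of `G` which are values of words of length at most `R` in the letters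
`s i` and their inverses: the vertices at distance at most `R` from `1` in the Cayley graph
of `G` with respect to `s`. -/
def wordBall {ι G : Type*} [Group G] (s : ι → G) (R : ℕ) : Set G :=
  {g | ∃ l : List (ι × Bool), l.length ≤ R ∧ FreeGroup.lift s (FreeGroup.mk l) = g}

/-- The balls of radius `R` around `1` in the marked Cayley graphs of `(G, s)` and `(H, t)` are
isomorphic as rooted graphs whose edges `x → x * s i` carry the mark `i`. -/
def BallsIso {ι G H : Type*} [Group G] [Group H] (s : ι → G) (t : ι → H) (R : ℕ) : Prop :=
  ∃ φ : wordBall s R ≃ wordBall t R,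
    (∀ x : wordBall s R, (x : G) = 1 → (φ x : H) = 1) ∧
    ∀ (i : ι) (x y : wordBall s R),
      (x : G) * s i = (y : G) ↔ (φ x : H) * t i = (φ y : H)

/-- `G` preforms `H`: there are a finite generating set `T` of `H` and finite generating sets
`S₀, S₁, …` of `G`, with bijections `T → Sₙ` (given here as injections `s n : T → G` with
image `Sₙ`), such that for every `R`, for all large `n`, the balls of radius `R` in the marked
Cayley graphs of `(G, Sₙ)` and `(H, T)` are isomorphic. -/
def Preforms (G H : Type*) [Group G] [Group H] : Prop :=
  ∃ T : Finset H, Subgroup.closure (T : Set H) = ⊤ ∧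
    ∃ s : ℕ → T → G,
      (∀ n, Function.Injective (s n) ∧ Subgroup.closure (Set.range (s n)) = ⊤) ∧
      ∀ R : ℕ, ∃ n₀ : ℕ, ∀ n ≥ n₀, BallsIso (s n) (fun t : T => (t : H)) R

/-! ### Identities, varieties and verbal subgroups -/

/-- The variety generated by `G`, as the set of identities of `G`: the words `w` in countably many
variables such that `w(g₀, g₁, …) = 1` for all `g₀, g₁, …` in `G`. -/
def identities (G : Type*) [Group G] : Set (FreeGroup ℕ) :=
  {w | ∀ g : ℕ → G, FreeGroup.lift g w = 1}

/-- The verbal subgroup of `G` for a set `W` of words: the subgroup generated by all the values in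
`G` of words of `W`. -/
def verbalSubgroup (W : Set (FreeGroup ℕ)) (G : Type*) [Group G] : Subgroup G :=
  Subgroup.closure {x | ∃ w ∈ W, ∃ g : ℕ → G, FreeGroup.lift g w = x}

/-! ### The torsion subgroup of a nilpotent group -/

theorem isOfFinOrder_of_lowerCentralSeries (n : ℕ) : ∀ {G : Type*} [Group G],
    (⊤ : Subgroup G).lowerCentralSeries n = ⊥ → ∀ S : Set G, (∀ x ∈ S, IsOfFinOrder x) →
    Subgroup.closure S = ⊤ → ∀ g : G, IsOfFinOrder g := by
  induction n with
  | zero =>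
    intro G _ h S _ _ g
    have hg : g ∈ (⊥ : Subgroup G) := h ▸ Subgroup.mem_top g
    rw [Subgroup.mem_bot.1 hg]
    exact IsOfFinOrder.one
  | succ n ih =>
    intro G _ h S hS hcl g
    set N := (⊤ : Subgroup G).lowerCentralSeries n with hN
    have hcent : ∀ x ∈ N, ∀ y : G, Commute y x := by
      intro x hx y
      have h1 : N ≤ Subgroup.centralizer ((⊤ : Subgroup G) : Set G) :=
        Subgroup.commutator_eq_bot_iff_le_centralizer.1 h
      exact Subgroup.mem_centralizer_iff.1 (h1 hx) y (Subgroup.mem_top y)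
    have hNtors : ∀ x ∈ N, IsOfFinOrder x := by
      cases n with
      | zero =>
        intro x _
        have hx : x ∈ Subgroup.closure S := hcl ▸ Subgroup.mem_top x
        induction hx using Subgroup.closure_induction with
        | mem x hx => exact hS x hx
        | one => exact IsOfFinOrder.one
        | mul x y _ _ hx hy =>
          exact (hcent y (Subgroup.mem_top y) x).isOfFinOrder_mul (hx (Subgroup.mem_top x))
            (hy (Subgroup.mem_top y))
        | inv x _ hx => exact (hx (Subgroup.mem_top x)).inv
      | succ m =>
        have key : ∀ p ∈ (⊤ : Subgroup G).lowerCentralSeries m, ∀ q : G, IsOfFinOrder ⁅p, q⁆ := by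
          intro p hp
          have hmem : ∀ q : G, ⁅p, q⁆ ∈ N := fun q =>
            Subgroup.commutator_mem_commutator hp (Subgroup.mem_top q)
          let f : G →* G := MonoidHom.mk' (fun q => ⁅p, q⁆) (by
            intro a b
            have hc : a * ⁅p, b⁆ = ⁅p, b⁆ * a := hcent _ (hmem b) a
            have h2 : ⁅p, a * b⁆ = ⁅p, a⁆ * (a * ⁅p, b⁆ * a⁻¹) := by
              simp only [commutatorElement_def]; group
            change ⁅p, a * b⁆ = ⁅p, a⁆ * ⁅p, b⁆
            rw [h2, hc, mul_inv_cancel_right])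
          intro q
          have hq : q ∈ Subgroup.closure S := hcl ▸ Subgroup.mem_top q
          change IsOfFinOrder (f q)
          induction hq using Subgroup.closure_induction with
          | mem x hx => exact f.isOfFinOrder (hS x hx)
          | one => rw [map_one]; exact IsOfFinOrder.one
          | mul x y _ _ hx hy =>
            rw [map_mul]
            exact (hcent (f y) (hmem y) (f x)).isOfFinOrder_mul hx hy
          | inv x _ hx => rw [map_inv]; exact hx.inv
        intro x hx
        have hx' := (Subgroup.mem_lowerCentralSeries_succ_iff (S := (⊤ : Subgroup G)) m x).1 hx
        have hsub : ∀ z ∈ {x | ∃ p ∈ (⊤ : Subgroup G).lowerCentralSeries m,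
            ∃ q ∈ (⊤ : Subgroup G), ⁅p, q⁆ = x}, z ∈ N := by
          rintro _ ⟨p, hp, q, hq, rfl⟩
          exact Subgroup.commutator_mem_commutator hp hq
        have hle := (Subgroup.closure_le N).2 hsub
        clear hx
        induction hx' using Subgroup.closure_induction with
        | mem x hx => obtain ⟨p, hp, q, _, rfl⟩ := hx; exact key p hp q
        | one => exact IsOfFinOrder.one
        | mul x y _ hyc hx hy => exact (hcent y (hle hyc) x).isOfFinOrder_mul hx hy
        | inv x _ hx => exact hx.inv
    have hq : IsOfFinOrder (QuotientGroup.mk' N g) := by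
      refine ih ?_ (QuotientGroup.mk' N '' S) ?_ ?_ _
      · have h3 := Subgroup.map_lowerCentralSeries (⊤ : Subgroup G) (QuotientGroup.mk' N) n
        rw [Subgroup.map_top_of_surjective _ (QuotientGroup.mk'_surjective N)] at h3
        rw [← h3, Subgroup.map_eq_bot_iff, QuotientGroup.ker_mk']
      · rintro _ ⟨x, hx, rfl⟩
        exact (QuotientGroup.mk' N).isOfFinOrder (hS x hx)
      · rw [← MonoidHom.map_closure, hcl,
          Subgroup.map_top_of_surjective _ (QuotientGroup.mk'_surjective N)]
    obtain ⟨k, hk, hk1⟩ := isOfFinOrder_iff_pow_eq_one.1 hq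
    rw [← map_pow] at hk1
    have hkN : g ^ k ∈ N := by
      rw [← QuotientGroup.ker_mk' N]; exact hk1
    exact (hNtors _ hkN).of_pow hk.ne'

theorem isOfFinOrder_mul_of_isNilpotent {G : Type*} [Group G] [Group.IsNilpotent G] {a b : G}
    (ha : IsOfFinOrder a) (hb : IsOfFinOrder b) : IsOfFinOrder (a * b) := by
  obtain ⟨n, hn⟩ := Subgroup.nilpotent_iff_lowerCentralSeries.1
    (inferInstance : Group.IsNilpotent (Subgroup.closure ({a, b} : Set G)))
  have hmem : a * b ∈ Subgroup.closure ({a, b} : Set G) :=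
    mul_mem (Subgroup.subset_closure (by simp)) (Subgroup.subset_closure (by simp))
  have h := isOfFinOrder_of_lowerCentralSeries n hn
    (((↑) : Subgroup.closure ({a, b} : Set G) → G) ⁻¹' {a, b}) (by
      rintro ⟨x, hx⟩ h
      rw [← Submonoid.isOfFinOrder_coe]
      rcases h with h | h
      · exact (show x = a from h) ▸ ha
      · exact (show x = b from h) ▸ hb) Subgroup.closure_closure_coe_preimage ⟨a * b, hmem⟩
  exact (Subgroup.subtype _).isOfFinOrder h

/-- The torsion subgroup of a nilpotent group: the set of all its elements of finite order. -/
def torsionSubgroup (G : Type*) [Group G] [Group.IsNilpotent G] : Subgroup G where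
  carrier := {g | IsOfFinOrder g}
  one_mem' := IsOfFinOrder.one
  mul_mem' := isOfFinOrder_mul_of_isNilpotent
  inv_mem' := IsOfFinOrder.inv

instance torsionSubgroup_normal (G : Type*) [Group G] [Group.IsNilpotent G] :
    (torsionSubgroup G).Normal :=
  ⟨fun x hx g => (isConj_iff.2 ⟨g, rfl⟩ : IsConj x (g * x * g⁻¹)).isOfFinOrder hx⟩

/-! ### Invariance under isomorphism -/

theorem identities_subset_of_mulEquiv {G H : Type*} [Group G] [Group H] (e : G ≃* H) :
    identities G ⊆ identities H := by
  intro w hw g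
  have h1 : FreeGroup.lift g = (e : G →* H).comp (FreeGroup.lift (fun i => e.symm (g i))) := by
    ext i; simp
  rw [h1, MonoidHom.comp_apply, hw, map_one]

theorem identities_congr {G H : Type*} [Group G] [Group H] (e : G ≃* H) :
    identities G = identities H :=
  (identities_subset_of_mulEquiv e).antisymm (identities_subset_of_mulEquiv e.symm)

theorem mem_wordBall_of_mulEquiv {ι κ G H : Type*} [Group G] [Group H] (e : G ≃* H) (j : κ ≃ ι)
    (s : ι → G) (R : ℕ) {g : G} (hg : g ∈ wordBall s R) :
    e g ∈ wordBall (fun k => e (s (j k))) R := by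
  obtain ⟨l, hl, rfl⟩ := hg
  refine ⟨l.map fun p => (j.symm p.1, p.2), by simpa using hl, ?_⟩
  simp only [FreeGroup.lift_mk, map_list_prod, List.map_map]
  congr 1
  refine List.map_congr_left ?_
  rintro ⟨i, b⟩ _
  cases b <;> simp

/-- A group isomorphism together with a relabelling of the generators identifies the balls. -/
def wordBallEquiv {ι κ G H : Type*} [Group G] [Group H] (e : G ≃* H) (j : κ ≃ ι)
    (s : ι → G) (R : ℕ) : wordBall s R ≃ wordBall (fun k => e (s (j k))) R where
  toFun x := ⟨e x, mem_wordBall_of_mulEquiv e j s R x.2⟩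
  invFun y := ⟨e.symm y, by
    simpa using mem_wordBall_of_mulEquiv e.symm j.symm (fun k => e (s (j k))) R y.2⟩
  left_inv x := by simp
  right_inv y := by simp

theorem BallsIso.congr {ι κ G G' H H' : Type*} [Group G] [Group G'] [Group H] [Group H']
    (e : G ≃* G') (f : H ≃* H') (j : κ ≃ ι) {s : ι → G} {t : ι → H} {R : ℕ}
    (h : BallsIso s t R) :
    BallsIso (fun k => e (s (j k))) (fun k => f (t (j k))) R := by
  obtain ⟨φ, h1, h2⟩ := h
  refine ⟨((wordBallEquiv e j s R).symm.trans φ).trans (wordBallEquiv f j t R), ?_, ?_⟩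
  · intro x hx
    have h3 : (((wordBallEquiv e j s R).symm x : wordBall s R) : G) = 1 := by
      change e.symm (x : G') = 1
      rw [hx, map_one]
    change f (φ _ : H) = 1
    rw [h1 _ h3, map_one]
  · intro k x y
    obtain ⟨x, rfl⟩ := (wordBallEquiv e j s R).surjective x
    obtain ⟨y, rfl⟩ := (wordBallEquiv e j s R).surjective y
    have h3 := h2 (j k) x y
    simp only [Equiv.trans_apply, Equiv.symm_apply_apply]
    change e (x : G) * e (s (j k)) = e (y : G) ↔ f (φ x : H) * f (t (j k)) = f (φ y : H)
    rw [← map_mul, ← map_mul, e.apply_eq_iff_eq, f.apply_eq_iff_eq]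
    exact h3

theorem Preforms.congr {G G' H H' : Type*} [Group G] [Group G'] [Group H] [Group H']
    (e : G ≃* G') (f : H ≃* H') (h : Preforms G H) : Preforms G' H' := by
  obtain ⟨T, hT, s, hs, hR⟩ := h
  let j : (T.map f.toEquiv.toEmbedding) ≃ T :=
    { toFun := fun k => ⟨f.symm k, by
        obtain ⟨y, hy, hyk⟩ := Finset.mem_map.1 k.2
        rw [← hyk]; simpa using hy⟩
      invFun := fun t => ⟨f t, by simp⟩
      left_inv := fun k => Subtype.ext (f.apply_symm_apply _)
      right_inv := fun t => by simp }
  refine ⟨T.map f.toEquiv.toEmbedding, ?_, fun n k => e (s n (j k)), fun n => ⟨?_, ?_⟩, ?_⟩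
  · have h1 : ((T.map f.toEquiv.toEmbedding : Finset H') : Set H') = (f : H →* H') '' T := by
      simp
    rw [h1, ← MonoidHom.map_closure, hT, Subgroup.map_top_of_surjective _ f.surjective]
  · exact e.injective.comp ((hs n).1.comp j.injective)
  · have h1 : Set.range (fun k => e (s n (j k))) = (e : G →* G') '' Set.range (s n) := by
      rw [← Set.range_comp]
      exact j.surjective.range_comp (fun t => e (s n t))
    rw [h1, ← MonoidHom.map_closure, (hs n).2, Subgroup.map_top_of_surjective _ e.surjective]
  · intro R
    obtain ⟨n₀, hn₀⟩ := hR R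
    refine ⟨n₀, fun n hn => ?_⟩
    have h1 := (hn₀ n hn).congr e f j
    have h2 : (fun k : (T.map f.toEquiv.toEmbedding) => (k : H')) = fun k => f (j k : H) := by
      funext k
      exact (f.apply_symm_apply _).symm
    rw [h2]
    exact h1

/-! ### The graph of isomorphism classes of finitely generated groups -/

/-- Finitely generated groups. -/
structure FGGroup where
  carrier : Type u
  [group : Group carrier]
  [fg : Group.FG carrier]

attribute [instance] FGGroup.group FGGroup.fg

/-- Isomorphism of finitely generated groups. -/
instance FGGroup.isoSetoid : Setoid FGGroup.{u} where
  r A B := Nonempty (A.carrier ≃* B.carrier)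
  iseqv :=
    { refl := fun _ => ⟨MulEquiv.refl _⟩
      symm := fun ⟨e⟩ => ⟨e.symm⟩
      trans := fun ⟨e⟩ ⟨f⟩ => ⟨e.trans f⟩ }

/-- Isomorphism classes of finitely generated groups. (A finitely generated group is countable,
so it has an isomorphic copy in each universe.) -/
def FGGroupClass : Type (u + 1) := Quotient FGGroup.isoSetoid.{u}

namespace FGGroupClass

/-- The isomorphism class of a finitely generated group. -/
def of (G : Type u) [Group G] [Group.FG G] : FGGroupClass.{u} :=
  Quotient.mk FGGroup.isoSetoid ⟨G⟩

/-- The relation of preforming, on isomorphism classes. -/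
def Preforms (a b : FGGroupClass.{u}) : Prop :=
  Quotient.liftOn₂ a b (fun A B => _root_.Preforms A.carrier B.carrier)
    (fun _ _ _ _ ⟨e⟩ ⟨f⟩ => propext ⟨fun h => h.congr e f, fun h => h.congr e.symm f.symm⟩)

/-- The variety generated by the groups of an isomorphism class, as a set of identities. -/
def identities (a : FGGroupClass.{u}) : Set (FreeGroup ℕ) :=
  Quotient.liftOn a (fun A => _root_.identities A.carrier) (fun _ _ ⟨e⟩ => identities_congr e)

/-- The isomorphism classes of finitely generated groups generating the variety `V`. -/
def generators (V : Set (FreeGroup ℕ)) : Set FGGroupClass.{u} :=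
  {a | a.identities = V}

/-- The underlying unoriented graph of the relation of preforming. -/
def graph : SimpleGraph FGGroupClass.{u} := SimpleGraph.fromRel Preforms

/-- The connected component of a finitely generated group for the relation of preforming. -/
def component (G : Type u) [Group G] [Group.FG G] :
    graph.{u}.ConnectedComponent :=
  graph.connectedComponentMk (of G)

end FGGroupClass

/-! Finitely generated nilpotent groups are noetherian, hence finitely presented. If `G` preforms a
nilpotent `H`, a sufficiently good marking of `G` satisfies defining relators of `H`, so `G` is a
quotient of `H` by a map injective on any prescribed finite set
(`Preforms.hasSeparatingSurjections`). Nilpotency is a finite condition on generators, so it crosses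
edges both ways. Hence identities and cardinalities of verbal subgroups are constant on components
of nilpotent groups.

Conversely, let `G/Torsion` generate the variety; this property depends on the variety only. Every
nontrivial finitely generated `H` in the variety's generating class then preforms the relatively
free group of rank 2k as soon as k elements generate `H` (`preforms_relativelyFree`). Taking the
same k for `G` and `H` joins them through that group. The point is to find a generating 2k-tuple of
`H` at which finitely many given non-identities are all nontrivial
(`exists_generating_lift_ne_one`). Each takes a value of infinite order, which survives in a
quotient of p-power exponent for every prime p; different primes serve different words, and the
Chinese remainder theorem glues the choices.

If `G/Torsion` satisfies more identities than `G`, let W be the set of its identities. Then W(G) is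
nontrivial and lies in the finite torsion subgroup, and W(Gⁿ) = W(G)ⁿ, so the cardinalities separate
the components of the powers. -/

/-! ### Left-normed commutators of generators -/

/-- The left-normed commutators of weight `n + 1` in the free generators. -/
def commWords (ι : Type*) : ℕ → Set (FreeGroup ι)
  | 0 => Set.range FreeGroup.of
  | n + 1 => Set.image2 (fun v i => ⁅v, FreeGroup.of i⁆) (commWords ι n) Set.univ

theorem commWords_finite (ι : Type*) [Finite ι] (n : ℕ) : (commWords ι n).Finite := by
  induction n with
  | zero => exact Set.finite_range _
  | succ n ih => exact ih.image2 _ Set.finite_univ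

theorem lift_commWords_mem {ι H : Type*} [Group H] (s : ι → H) (n : ℕ) :
    ∀ w ∈ commWords ι n, FreeGroup.lift s w ∈ (⊤ : Subgroup H).lowerCentralSeries n := by
  induction n with
  | zero => intro w _; exact Subgroup.mem_top _
  | succ n ih =>
    rintro _ ⟨v, hv, i, -, rfl⟩
    rw [map_commutatorElement]
    exact Subgroup.commutator_mem_commutator (ih v hv) (Subgroup.mem_top _)

theorem lift_mk_comp {ι H : Type*} [Group H] (N : Subgroup H) [N.Normal] (s : ι → H)
    (w : FreeGroup ι) :
    FreeGroup.lift (fun i => QuotientGroup.mk' N (s i)) w =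
      QuotientGroup.mk' N (FreeGroup.lift s w) := by
  have : FreeGroup.lift (fun i => QuotientGroup.mk' N (s i)) =
      (QuotientGroup.mk' N).comp (FreeGroup.lift s) := by ext i; simp
  rw [this, MonoidHom.comp_apply]

theorem closure_range_mk {ι H : Type*} [Group H] (N : Subgroup H) [N.Normal] {s : ι → H}
    (hs : Subgroup.closure (Set.range s) = ⊤) :
    Subgroup.closure (Set.range fun i => QuotientGroup.mk' N (s i)) = ⊤ := by
  have : (Set.range fun i => QuotientGroup.mk' N (s i)) = QuotientGroup.mk' N '' Set.range s := by
    rw [← Set.range_comp]; rfl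
  rw [this, ← MonoidHom.map_closure, hs,
    Subgroup.map_top_of_surjective _ (QuotientGroup.mk'_surjective N)]

theorem lift_surjective {ι H : Type*} [Group H] {s : ι → H}
    (hs : Subgroup.closure (Set.range s) = ⊤) : Function.Surjective (FreeGroup.lift s) := by
  rw [← MonoidHom.range_eq_top, FreeGroup.range_lift_eq_closure, hs]

/-- If the commutators of weight `n + 2` in the generators vanish, then those of weight `n + 1`
are central. -/
theorem closure_commWords_le_center {ι H : Type*} [Group H] {s : ι → H}
    (hs : Subgroup.closure (Set.range s) = ⊤) {n : ℕ}
    (h : ∀ w ∈ commWords ι (n + 1), FreeGroup.lift s w = 1) :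
    Subgroup.closure (FreeGroup.lift s '' commWords ι n) ≤ Subgroup.center H := by
  rw [Subgroup.closure_le]
  rintro _ ⟨v, hv, rfl⟩
  have h1 : Subgroup.closure (Set.range s) ≤ Subgroup.centralizer {FreeGroup.lift s v} := by
    rw [Subgroup.closure_le]
    rintro _ ⟨i, rfl⟩
    have h2 := h _ ⟨v, hv, i, trivial, rfl⟩
    rw [map_commutatorElement, FreeGroup.lift_apply_of, commutatorElement_eq_one_iff_mul_comm] at h2
    rw [SetLike.mem_coe, Subgroup.mem_centralizer_iff]
    rintro _ rfl
    exact h2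
  rw [hs] at h1
  rw [SetLike.mem_coe, Subgroup.mem_center_iff]
  intro g
  exact (Subgroup.mem_centralizer_iff.1 (h1 (Subgroup.mem_top g)) _ rfl).symm

theorem normal_of_le_center {H : Type*} [Group H] {N : Subgroup H} (h : N ≤ Subgroup.center H) :
    N.Normal :=
  ⟨fun x hx g => by
    rw [Subgroup.mem_center_iff.1 (h hx) g, mul_inv_cancel_right]; exact hx⟩

/-- A central subgroup is commutative. -/
abbrev commGroupOfLeCenter {H : Type*} [Group H] {N : Subgroup H} (h : N ≤ Subgroup.center H) :
    CommGroup N :=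
  { (inferInstance : Group N) with
    mul_comm := fun a b => Subtype.ext (Subgroup.mem_center_iff.1 (h b.2) a) }

/-- Commutators that commute with all generators generate a central subgroup `N`. By induction
modulo `N`, the previous term of the series lies in `N`, so the next one vanishes. -/
theorem lowerCentralSeries_eq_bot_of_commWords {ι : Type*} (n : ℕ) :
    ∀ {H : Type*} [Group H] {s : ι → H}, Subgroup.closure (Set.range s) = ⊤ →
      (∀ w ∈ commWords ι n, FreeGroup.lift s w = 1) →
      (⊤ : Subgroup H).lowerCentralSeries n = ⊥ := by
  induction n with
  | zero =>
    intro H _ s hs h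
    rw [Subgroup.lowerCentralSeries_zero, ← hs, Subgroup.closure_eq_bot_iff]
    rintro _ ⟨i, rfl⟩
    simpa using h _ ⟨i, rfl⟩
  | succ n ih =>
    intro H _ s hs h
    have hc := closure_commWords_le_center hs h
    set N := Subgroup.closure (FreeGroup.lift s '' commWords ι n)
    have := normal_of_le_center hc
    have h1 := ih (closure_range_mk N hs) (fun w hw => by
      rw [lift_mk_comp]
      exact (QuotientGroup.eq_one_iff _).2 (Subgroup.subset_closure ⟨w, hw, rfl⟩))
    have h3 := Subgroup.map_lowerCentralSeries (⊤ : Subgroup H) (QuotientGroup.mk' N) n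
    rw [Subgroup.map_top_of_surjective _ (QuotientGroup.mk'_surjective N), h1,
      Subgroup.map_eq_bot_iff, QuotientGroup.ker_mk'] at h3
    rw [Subgroup.lowerCentralSeries_succ, Subgroup.commutator_eq_bot_iff_le_centralizer]
    intro x hx
    rw [Subgroup.mem_centralizer_iff]
    intro y _
    exact Subgroup.mem_center_iff.1 (hc (h3 hx)) y

/-! ### Finitely generated nilpotent groups are noetherian -/

theorem wellFoundedGT_subgroup_of_commGroup (A : Type*) [CommGroup A] [Group.FG A] :
    WellFoundedGT (Subgroup A) := by
  have : Module.Finite ℤ (Additive A) := Module.Finite.iff_addGroup_fg.mpr inferInstance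
  have : WellFoundedGT (Submodule ℤ (Additive A)) := inferInstance
  exact ((Subgroup.toAddSubgroup (G := A)).trans
    AddSubgroup.toIntSubmodule).strictMono.wellFoundedGT

/-- Nested subgroups with the same intersection with `N` and the same image in `H ⧸ N` coincide. -/
theorem wellFoundedGT_subgroup_of_extension {H : Type*} [Group H] (N : Subgroup H) [N.Normal]
    [WellFoundedGT (Subgroup N)] [WellFoundedGT (Subgroup (H ⧸ N))] :
    WellFoundedGT (Subgroup H) := by
  let f : Subgroup H → Subgroup N × Subgroup (H ⧸ N) := fun K =>
    (K.subgroupOf N, K.map (QuotientGroup.mk' N))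
  have hmono : Monotone f := fun K L h =>
    ⟨Subgroup.comap_mono h, Subgroup.map_mono h⟩
  have hf : StrictMono f := by
    intro K L h
    refine lt_of_le_of_ne (hmono h.le) fun he => h.not_ge ?_
    intro x hx
    have h1 : K.subgroupOf N = L.subgroupOf N := congrArg Prod.fst he
    have h2 : K.map (QuotientGroup.mk' N) = L.map (QuotientGroup.mk' N) := congrArg Prod.snd he
    have h3 : QuotientGroup.mk' N x ∈ K.map (QuotientGroup.mk' N) :=
      h2 ▸ Subgroup.mem_map_of_mem _ hx
    obtain ⟨y, hy, hyx⟩ := h3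
    have h4 : y⁻¹ * x ∈ N := QuotientGroup.eq.1 hyx
    have h5 : (⟨y⁻¹ * x, h4⟩ : N) ∈ K.subgroupOf N := by
      rw [h1]
      exact L.mul_mem (L.inv_mem (h.le hy)) hx
    have h6 : y⁻¹ * x ∈ K := h5
    simpa using K.mul_mem hy h6
  exact hf.wellFoundedGT

theorem wellFoundedGT_subgroup_of_commWords {ι : Type*} [Finite ι] (n : ℕ) :
    ∀ {H : Type*} [Group H] {s : ι → H}, Subgroup.closure (Set.range s) = ⊤ →
      (∀ w ∈ commWords ι n, FreeGroup.lift s w = 1) → WellFoundedGT (Subgroup H) := by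
  induction n with
  | zero =>
    intro H _ s hs h
    have h1 : (⊤ : Subgroup H) = ⊥ := lowerCentralSeries_eq_bot_of_commWords 0 hs h
    have : Subsingleton H := Subgroup.subsingleton_iff.1 (subsingleton_of_bot_eq_top h1.symm)
    infer_instance
  | succ n ih =>
    intro H _ s hs h
    have hc := closure_commWords_le_center hs h
    have hfin : (FreeGroup.lift s '' commWords ι n).Finite := (commWords_finite ι n).image _
    have := hfin.to_subtype
    have hfg : Group.FG (Subgroup.closure (FreeGroup.lift s '' commWords ι n)) :=
      Group.closure_finite_fg _
    have hN : ∀ w ∈ commWords ι n, FreeGroup.lift s w ∈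
      Subgroup.closure (FreeGroup.lift s '' commWords ι n) :=
      fun w hw => Subgroup.subset_closure ⟨w, hw, rfl⟩
    generalize Subgroup.closure (FreeGroup.lift s '' commWords ι n) = N at hc hfg hN
    have := normal_of_le_center hc
    let _ := commGroupOfLeCenter hc
    have := wellFoundedGT_subgroup_of_commGroup N
    have := ih (closure_range_mk N hs) (fun w hw => by
      rw [lift_mk_comp]
      exact (QuotientGroup.eq_one_iff _).2 (hN w hw))
    exact wellFoundedGT_subgroup_of_extension N

theorem exists_generating_family (H : Type u) [Group H] [Group.FG H] :
    ∃ (ι : Type u) (_ : Fintype ι) (s : ι → H), Subgroup.closure (Set.range s) = ⊤ := by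
  obtain ⟨S, hS⟩ := Group.fg_def.1 (inferInstance : Group.FG H)
  exact ⟨S, inferInstance, fun x => x, by simpa using hS⟩

theorem exists_commWords_trivial (H : Type*) [Group H] [Group.IsNilpotent H] :
    ∃ n, ∀ {ι : Type u} (s : ι → H), ∀ w ∈ commWords ι n, FreeGroup.lift s w = 1 := by
  obtain ⟨n, hn⟩ := Subgroup.nilpotent_iff_lowerCentralSeries.1 (inferInstance : Group.IsNilpotent H)
  exact ⟨n, fun s w hw => Subgroup.mem_bot.1 (hn ▸ lift_commWords_mem s n w hw)⟩

theorem wellFoundedGT_subgroup_of_nilpotent (H : Type*) [Group H] [Group.FG H]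
    [Group.IsNilpotent H] : WellFoundedGT (Subgroup H) := by
  obtain ⟨ι, _, s, hs⟩ := exists_generating_family H
  obtain ⟨n, hn⟩ := exists_commWords_trivial H
  exact wellFoundedGT_subgroup_of_commWords n hs (hn s)

theorem Subgroup.fg_of_wellFoundedGT {H : Type*} [Group H] [WellFoundedGT (Subgroup H)]
    (K : Subgroup H) : K.FG := by
  obtain ⟨M, ⟨hMK, hM⟩, hmax⟩ := WellFounded.has_min (wellFounded_gt (α := Subgroup H))
    {M | M ≤ K ∧ M.FG} ⟨⊥, bot_le, ⟨∅, by simp⟩⟩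
  suffices M = K from this ▸ hM
  refine hMK.antisymm fun x hx => ?_
  have h1 : M ⊔ Subgroup.zpowers x ≤ K := sup_le hMK (Subgroup.zpowers_le.2 hx)
  have h2 : (M ⊔ Subgroup.zpowers x).FG := hM.sup ⟨{x}, by
    simp [Subgroup.zpowers_eq_closure]⟩
  have h3 := hmax _ ⟨h1, h2⟩
  by_contra hxM
  refine h3 (lt_of_le_of_ne le_sup_left fun he => hxM ?_)
  rw [he]
  exact Subgroup.mem_sup_right (Subgroup.mem_zpowers x)

/-- Induction on the central quotient: the centre is a finitely generated torsion abelian group,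
hence finite. -/
theorem finite_of_nilpotent_of_torsion (H : Type*) [Group H] [Group.IsNilpotent H] :
    WellFoundedGT (Subgroup H) → (∀ x : H, IsOfFinOrder x) → Finite H := by
  refine Group.nilpotent_center_quotient_ind
    (P := fun H _ _ => WellFoundedGT (Subgroup H) → (∀ x : H, IsOfFinOrder x) → Finite H) H ?_ ?_
  · intro H _ _ _ _
    infer_instance
  · intro H _ _ ih h1 h2
    have : Finite (H ⧸ Subgroup.center H) := by
      refine ih ?_ ?_
      · have : StrictMono (Subgroup.comap (QuotientGroup.mk' (Subgroup.center H))) := fun _ _ h =>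
          (Subgroup.comap_lt_comap_of_surjective (QuotientGroup.mk'_surjective _)).2 h
        exact this.wellFoundedGT
      · intro x
        obtain ⟨y, rfl⟩ := QuotientGroup.mk'_surjective _ x
        exact (QuotientGroup.mk' _).isOfFinOrder (h2 y)
    have : Group.FG (Subgroup.center H) :=
      (Group.fg_iff_subgroup_fg _).2 (Subgroup.fg_of_wellFoundedGT _)
    let _ := commGroupOfLeCenter (le_refl (Subgroup.center H))
    have : Finite (Subgroup.center H) :=
      CommGroup.finite_of_fg_isMulTorsion _ (fun x => Submonoid.isOfFinOrder_coe.1 (h2 x))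
    exact Finite.of_subgroup_quotient (Subgroup.center H)

theorem finite_torsionSubgroup (H : Type*) [Group H] [Group.FG H] [Group.IsNilpotent H] :
    Finite (torsionSubgroup H) := by
  have := wellFoundedGT_subgroup_of_nilpotent H
  refine finite_of_nilpotent_of_torsion _ ?_ fun x => Submonoid.isOfFinOrder_coe.1 x.2
  have : StrictMono (Subgroup.map (torsionSubgroup H).subtype) :=
    Monotone.strictMono_of_injective (fun _ _ h => Subgroup.map_mono h)
      (Subgroup.map_injective (torsionSubgroup H).subtype_injective)
  exact this.wellFoundedGT

/-! ### Isomorphic balls and common relations -/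

theorem lift_mk_concat {ι G : Type*} [Group G] (s : ι → G) (l : List (ι × Bool)) (i : ι)
    (b : Bool) : FreeGroup.lift s (FreeGroup.mk (l ++ [(i, b)])) =
      FreeGroup.lift s (FreeGroup.mk l) * cond b (s i) (s i)⁻¹ := by
  cases b <;> simp [FreeGroup.lift_mk]

theorem lift_mk_inv_append {ι G : Type*} [Group G] (s : ι → G) (l l' : List (ι × Bool)) :
    FreeGroup.lift s (FreeGroup.mk (FreeGroup.invRev l ++ l')) =
      (FreeGroup.lift s (FreeGroup.mk l))⁻¹ * FreeGroup.lift s (FreeGroup.mk l') := by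
  rw [← FreeGroup.mul_mk, ← FreeGroup.inv_mk, map_mul, map_inv]

/-- A word of length at most `R` traces a path inside the ball, and the isomorphism carries its
endpoint to the endpoint of the path with the same marks. -/
theorem BallsIso.lift_eq_one_iff {ι G H : Type*} [Group G] [Group H] {s : ι → G} {t : ι → H}
    {R : ℕ} (h : BallsIso s t R) (l : List (ι × Bool)) (hl : l.length ≤ R) :
    FreeGroup.lift s (FreeGroup.mk l) = 1 ↔ FreeGroup.lift t (FreeGroup.mk l) = 1 := by
  obtain ⟨φ, h1, h2⟩ := h
  have key : ∀ l : List (ι × Bool), ∀ hl : l.length ≤ R,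
      (φ ⟨FreeGroup.lift s (FreeGroup.mk l), l, hl, rfl⟩ : H) =
        FreeGroup.lift t (FreeGroup.mk l) := by
    intro l
    induction l using List.reverseRecOn with
    | nil =>
      intro hl
      have : FreeGroup.lift t (FreeGroup.mk []) = 1 := by simp
      rw [this]
      exact h1 _ (by simp)
    | append_singleton l p ih =>
      obtain ⟨i, b⟩ := p
      intro hl
      have hl' : l.length ≤ R := by
        rw [List.length_append] at hl
        omega
      have h3 := ih hl'
      rw [lift_mk_concat t, ← h3]
      cases b with
      | true =>
        refine ((h2 i ⟨_, l, hl', rfl⟩ ⟨_, l ++ [(i, true)], hl, rfl⟩).1 ?_).symm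
        exact (lift_mk_concat s l i true).symm
      | false =>
        refine eq_mul_inv_of_mul_eq
          ((h2 i ⟨_, l ++ [(i, false)], hl, rfl⟩ ⟨_, l, hl', rfl⟩).1 ?_)
        change FreeGroup.lift s (FreeGroup.mk (l ++ [(i, false)])) * s i = _
        rw [lift_mk_concat s l i false]
        exact inv_mul_cancel_right _ _
  have h3 := key l hl
  have h4 := key [] (Nat.zero_le R)
  have e1 : ∀ {K : Type _} [Group K] (r : ι → K), FreeGroup.lift r (FreeGroup.mk []) = 1 :=
    fun r => by simp
  have e2 : FreeGroup.lift t (FreeGroup.mk []) = 1 := by simp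
  rw [e2] at h4
  rw [← h3, ← h4]
  constructor
  · intro h5
    congr 2
    exact Subtype.ext (h5.trans (e1 s).symm)
  · intro h5
    have h6 := congrArg Subtype.val (φ.injective (Subtype.ext h5))
    exact h6.trans (e1 s)

/-- The bound is the length of a loop made of two radii and one edge, which decides whether two
vertices of the ball are adjacent. -/
theorem ballsIso_of_lift_eq_one_iff {ι G H : Type*} [Group G] [Group H] {s : ι → G} {t : ι → H}
    {R : ℕ} (h : ∀ l : List (ι × Bool), l.length ≤ 2 * R + 1 →
      (FreeGroup.lift s (FreeGroup.mk l) = 1 ↔ FreeGroup.lift t (FreeGroup.mk l) = 1)) :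
    BallsIso s t R := by
  have heq : ∀ l l' : List (ι × Bool), l.length + l'.length ≤ 2 * R + 1 →
      (FreeGroup.lift s (FreeGroup.mk l) = FreeGroup.lift s (FreeGroup.mk l') ↔
        FreeGroup.lift t (FreeGroup.mk l) = FreeGroup.lift t (FreeGroup.mk l')) := by
    intro l l' hl
    have h1 := h (FreeGroup.invRev l ++ l') (by
      rw [List.length_append, FreeGroup.invRev_length]; exact hl)
    rwa [lift_mk_inv_append, lift_mk_inv_append, inv_mul_eq_one, inv_mul_eq_one] at h1
  choose f hf hfs using fun x : wordBall s R => x.2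
  let φ : wordBall s R → wordBall t R := fun x => ⟨FreeGroup.lift t (FreeGroup.mk (f x)), f x, hf x, rfl⟩
  have hφ : Function.Bijective φ := by
    constructor
    · intro x y hxy
      have h1 := (heq (f x) (f y) (by have := hf x; have := hf y; omega)).2
        (congrArg Subtype.val hxy)
      rw [hfs, hfs] at h1
      exact Subtype.ext h1
    · rintro ⟨_, l, hl, rfl⟩
      refine ⟨⟨_, l, hl, rfl⟩, Subtype.ext ?_⟩
      exact (heq _ l (by have := hf ⟨_, l, hl, rfl⟩; omega)).1 (hfs _)
  refine ⟨Equiv.ofBijective φ hφ, ?_, ?_⟩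
  · intro x hx
    exact (h (f x) (by have := hf x; omega)).1 ((hfs x).trans hx)
  · intro i x y
    have h1 := heq (f x ++ [(i, true)]) (f y) (by
      have := hf x; have := hf y; rw [List.length_append, List.length_singleton]; omega)
    rw [lift_mk_concat, lift_mk_concat, hfs, hfs] at h1
    exact h1

/-- The marked group `(H, t)` is a limit of markings of `G`. -/
def IsMarkedLimit {ι : Type*} (G : Type*) {H : Type*} [Group G] [Group H] (t : ι → H) : Prop :=
  ∀ F : Finset (FreeGroup ι), ∃ s : ι → G, Subgroup.closure (Set.range s) = ⊤ ∧
    ∀ w ∈ F, (FreeGroup.lift s w = 1 ↔ FreeGroup.lift t w = 1)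

theorem Preforms.isMarkedLimit {G : Type*} {H : Type u} [Group G] [Group H] (h : Preforms G H) :
    ∃ (ι : Type u) (_ : Fintype ι) (t : ι → H), Subgroup.closure (Set.range t) = ⊤ ∧
      IsMarkedLimit G t := by
  classical
  obtain ⟨T, hT, s, hs, hR⟩ := h
  refine ⟨T, inferInstance, fun x => x, by simpa using hT, fun F => ?_⟩
  obtain ⟨n, hn⟩ := hR (F.sup fun w => w.toWord.length)
  refine ⟨s n, (hs n).2, fun w hw => ?_⟩
  have h1 := (hn n le_rfl).lift_eq_one_iff w.toWord
    (Finset.le_sup (f := fun w : FreeGroup T => w.toWord.length) hw)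
  rwa [FreeGroup.mk_toWord] at h1

theorem IsMarkedLimit.preforms {ι G H : Type*} [Group G] [Group H] [Fintype ι] {t : ι → H}
    (hinj : Function.Injective t) (ht : Subgroup.closure (Set.range t) = ⊤)
    (h : IsMarkedLimit G t) : Preforms G H := by
  classical
  -- Length 2n + 1 controls the balls of radius n; one more gives length 2 even for n = 0, enough to
  -- see that the marking is injective.
  have h1 : ∀ n : ℕ, ∃ s : ι → G, Subgroup.closure (Set.range s) = ⊤ ∧
      ∀ l : List (ι × Bool), l.length ≤ 2 * n + 2 →
        (FreeGroup.lift s (FreeGroup.mk l) = 1 ↔ FreeGroup.lift t (FreeGroup.mk l) = 1) := by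
    intro n
    obtain ⟨s, hs, hF⟩ := h ((List.finite_length_le (ι × Bool) (2 * n + 2)).toFinset.image
      FreeGroup.mk)
    refine ⟨s, hs, fun l hl => hF _ (Finset.mem_image_of_mem _ ?_)⟩
    simpa using hl
  choose s hs hF using h1
  let j : (Finset.univ.map ⟨t, hinj⟩ : Finset H) ≃ ι :=
    (Equiv.ofBijective (fun i => ⟨t i, Finset.mem_map_of_mem ⟨t, hinj⟩ (Finset.mem_univ i)⟩)
      ⟨fun a b hab => hinj (congrArg Subtype.val hab), fun ⟨x, hx⟩ => by
        obtain ⟨i, -, rfl⟩ := Finset.mem_map.1 hx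
        exact ⟨i, rfl⟩⟩).symm
  have hj : ∀ x : (Finset.univ.map ⟨t, hinj⟩ : Finset H), t (j x) = x := fun x =>
    congrArg Subtype.val (j.symm_apply_apply x)
  refine ⟨Finset.univ.map ⟨t, hinj⟩, by simpa using ht, fun n k => s n (j k), fun n => ⟨?_, ?_⟩, ?_⟩
  · refine Function.Injective.comp (fun a b hab => hinj ?_) j.injective
    have h2 := (hF n (FreeGroup.invRev [(a, true)] ++ [(b, true)]) (by simp)).1
    rw [lift_mk_inv_append, lift_mk_inv_append, inv_mul_eq_one, inv_mul_eq_one] at h2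
    simpa using h2 (by simpa using hab)
  · rw [← hs n]
    exact congrArg _ (j.surjective.range_comp (s n))
  · intro R
    refine ⟨R, fun n hn => ?_⟩
    have h2 : BallsIso (s n) t R :=
      ballsIso_of_lift_eq_one_iff fun l hl => hF n l (by omega)
    have h3 : BallsIso (fun k => s n (j k)) (fun k => t (j k)) R :=
      h2.congr (MulEquiv.refl G) (MulEquiv.refl H) j
    rw [funext hj] at h3
    exact h3

/-! ### Limits of nilpotent groups -/

/-- Nilpotency of bounded class amounts to finitely many equations in the generators, so a good
marking decides it in both directions. -/
theorem isNilpotent_iff_of_preforms {G H : Type*} [Group G] [Group H] (h : Preforms G H) :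
    Group.IsNilpotent G ↔ Group.IsNilpotent H := by
  obtain ⟨ι, _, t, ht, hlim⟩ := h.isMarkedLimit
  have key : ∀ n, ∃ s : ι → G, Subgroup.closure (Set.range s) = ⊤ ∧
      ((∀ w ∈ commWords ι n, FreeGroup.lift s w = 1) ↔
        ∀ w ∈ commWords ι n, FreeGroup.lift t w = 1) := by
    intro n
    obtain ⟨s, hs, hF⟩ := hlim (commWords_finite ι n).toFinset
    exact ⟨s, hs, forall₂_congr fun w hw => hF w (by simpa using hw)⟩
  constructor
  · intro _
    obtain ⟨n, hn⟩ := exists_commWords_trivial G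
    obtain ⟨s, hs, hst⟩ := key n
    exact Subgroup.nilpotent_iff_lowerCentralSeries.2
      ⟨n, lowerCentralSeries_eq_bot_of_commWords n ht (hst.1 (hn s))⟩
  · intro _
    obtain ⟨n, hn⟩ := exists_commWords_trivial H
    obtain ⟨s, hs, hst⟩ := key n
    exact Subgroup.nilpotent_iff_lowerCentralSeries.2
      ⟨n, lowerCentralSeries_eq_bot_of_commWords n hs (hst.2 (hn t))⟩

/-- Finitely generated nilpotent groups are finitely presented. -/
theorem exists_finite_relators {ι H : Type*} [Finite ι] [Group H] [Group.IsNilpotent H]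
    (t : ι → H) :
    ∃ F : Finset (FreeGroup ι), (∀ w ∈ F, FreeGroup.lift t w = 1) ∧
      ∀ {G : Type u} [Group G] (s : ι → G), Subgroup.closure (Set.range s) = ⊤ →
        (∀ w ∈ F, FreeGroup.lift s w = 1) → (FreeGroup.lift t).ker ≤ (FreeGroup.lift s).ker := by
  classical
  obtain ⟨n, hn⟩ := exists_commWords_trivial H
  -- The free nilpotent quotient is noetherian, so the relations of `H` have a finitely generated
  -- image there; lifts of its generators, with the commutators forcing nilpotency, are the
  -- relators.
  set Γ := (⊤ : Subgroup (FreeGroup ι)).lowerCentralSeries n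
  have : Group.IsNilpotent (FreeGroup ι ⧸ Γ) := by
    refine Subgroup.nilpotent_iff_lowerCentralSeries.2 ⟨n, ?_⟩
    have h3 := Subgroup.map_lowerCentralSeries (⊤ : Subgroup (FreeGroup ι)) (QuotientGroup.mk' Γ) n
    rw [Subgroup.map_top_of_surjective _ (QuotientGroup.mk'_surjective Γ)] at h3
    rw [← h3, Subgroup.map_eq_bot_iff, QuotientGroup.ker_mk']
  have := wellFoundedGT_subgroup_of_nilpotent (FreeGroup ι ⧸ Γ)
  obtain ⟨S, hS⟩ := Subgroup.fg_of_wellFoundedGT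
    ((FreeGroup.lift t).ker.map (QuotientGroup.mk' Γ))
  have hpre : ∀ x ∈ S, ∃ w ∈ (FreeGroup.lift t).ker, QuotientGroup.mk' Γ w = x := fun x hx =>
    (hS ▸ Subgroup.subset_closure hx : x ∈ (FreeGroup.lift t).ker.map (QuotientGroup.mk' Γ))
  choose! f hf hfS using hpre
  refine ⟨(commWords_finite ι n).toFinset ∪ S.image f, ?_, ?_⟩
  · intro w hw
    rcases Finset.mem_union.1 hw with hw | hw
    · exact hn t w (by simpa using hw)
    · obtain ⟨x, hx, rfl⟩ := Finset.mem_image.1 hw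
      exact hf x hx
  · intro G _ s hs hF w hw
    have hΓ : Γ ≤ (FreeGroup.lift s).ker := by
      rw [← Subgroup.map_eq_bot_iff, Subgroup.map_lowerCentralSeries, eq_bot_iff,
        ← lowerCentralSeries_eq_bot_of_commWords n hs
          (fun w hw => hF w (Finset.mem_union_left _ (by simpa using hw)))]
      exact Subgroup.lowerCentralSeries_mono n le_top
    have h1 : (S : Set (FreeGroup ι ⧸ Γ)) ⊆ ((FreeGroup.lift s).ker.map (QuotientGroup.mk' Γ) : Set (FreeGroup ι ⧸ Γ)) := by
      intro x hx
      exact ⟨f x, hF _ (Finset.mem_union_right _ (Finset.mem_image_of_mem f hx)), hfS x hx⟩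
    have h2 : QuotientGroup.mk' Γ w ∈ Subgroup.closure (S : Set (FreeGroup ι ⧸ Γ)) :=
      hS ▸ Subgroup.mem_map_of_mem _ hw
    obtain ⟨v, hv, hvw⟩ := (Subgroup.closure_le _).2 h1 h2
    have h3 := (FreeGroup.lift s).ker.mul_mem hv (hΓ (QuotientGroup.eq.1 hvw))
    simpa using h3

/-- Every finite subset of `H` embeds into `G` under some surjective homomorphism `H → G`. -/
def HasSeparatingSurjections (H G : Type*) [Group H] [Group G] : Prop :=
  ∀ F : Finset H, ∃ π : H →* G, Function.Surjective π ∧ Set.InjOn π F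

theorem MulEquiv.hasSeparatingSurjections {H G : Type*} [Group H] [Group G] (e : H ≃* G) :
    HasSeparatingSurjections H G :=
  fun _ => ⟨e, e.surjective, e.injective.injOn⟩

/-- Choose a marking of `G` that satisfies the finitely many relators of `H` and agrees with `H` on
the words expressing quotients of elements of `F`. -/
theorem Preforms.hasSeparatingSurjections {G H : Type u} [Group G] [Group H]
    [Group.IsNilpotent H] (h : Preforms G H) : HasSeparatingSurjections H G := by
  classical
  intro F
  obtain ⟨ι, _, t, ht, hlim⟩ := h.isMarkedLimit
  have htsurj := lift_surjective ht
  obtain ⟨A, hA1, hA2⟩ := exists_finite_relators t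
  choose g hg using htsurj
  obtain ⟨s, hs, hF⟩ := hlim (A ∪ (F ×ˢ F).image fun p => (g p.1)⁻¹ * g p.2)
  have hker := hA2 s hs fun w hw => (hF w (Finset.mem_union_left _ hw)).2 (hA1 w hw)
  let π : H →* G := (FreeGroup.lift t).liftOfSurjective (lift_surjective ht) ⟨FreeGroup.lift s, hker⟩
  have hπ : ∀ w, π (FreeGroup.lift t w) = FreeGroup.lift s w := fun w =>
    MonoidHom.liftOfRightInverse_comp_apply _ _ _ _ w
  refine ⟨π, ?_, ?_⟩
  · intro x
    obtain ⟨w, rfl⟩ := lift_surjective hs x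
    exact ⟨_, hπ w⟩
  · intro x hx y hy hxy
    have h1 := (hF ((g x)⁻¹ * g y) (Finset.mem_union_right _ (Finset.mem_image.2
      ⟨(x, y), Finset.mem_product.2 ⟨hx, hy⟩, rfl⟩))).1
    rw [map_mul, map_mul, map_inv, map_inv, ← hπ, ← hπ, hg, hg, inv_mul_eq_one,
      inv_mul_eq_one] at h1
    exact h1 hxy

/-! ### Identities and verbal subgroups under separating surjections -/

theorem map_lift {ι G H : Type*} [Group G] [Group H] (π : H →* G) (h : ι → H)
    (w : FreeGroup ι) : π (FreeGroup.lift h w) = FreeGroup.lift (fun i => π (h i)) w := by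
  have : FreeGroup.lift (fun i => π (h i)) = π.comp (FreeGroup.lift h) := by ext i; simp
  rw [this, MonoidHom.comp_apply]

theorem identities_subset_of_surjective {G H : Type*} [Group G] [Group H] {π : H →* G}
    (hπ : Function.Surjective π) : identities H ⊆ identities G := by
  intro w hw g
  choose h hh using fun i => hπ (g i)
  rw [← funext hh, ← map_lift, hw, map_one]

theorem HasSeparatingSurjections.identities_eq {G H : Type*} [Group G] [Group H]
    (h : HasSeparatingSurjections H G) : identities H = identities G := by
  classical
  obtain ⟨π, hπ, -⟩ := h ∅
  refine (identities_subset_of_surjective hπ).antisymm fun w hw x => ?_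
  obtain ⟨π, -, hπ⟩ := h {FreeGroup.lift x w, 1}
  refine hπ (by simp) (by simp) ?_
  rw [map_lift, hw, map_one]

theorem map_verbalSubgroup {G H : Type*} [Group G] [Group H] {π : H →* G}
    (hπ : Function.Surjective π) (W : Set (FreeGroup ℕ)) :
    (verbalSubgroup W H).map π = verbalSubgroup W G := by
  rw [verbalSubgroup, MonoidHom.map_closure, verbalSubgroup]
  congr 1
  ext x
  constructor
  · rintro ⟨_, ⟨w, hw, g, rfl⟩, rfl⟩
    exact ⟨w, hw, _, (map_lift π g w).symm⟩
  · rintro ⟨w, hw, g, rfl⟩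
    choose h hh using fun i => hπ (g i)
    refine ⟨_, ⟨w, hw, h, rfl⟩, ?_⟩
    rw [map_lift, funext hh]

/-- Verbal subgroups map onto verbal subgroups. Were the one in `H` larger, a surjection injective
on one element too many would be impossible. -/
theorem HasSeparatingSurjections.encard_verbalSubgroup {G H : Type u} [Group G] [Group H]
    (h : HasSeparatingSurjections H G) (W : Set (FreeGroup ℕ)) :
    (verbalSubgroup W H : Set H).encard = (verbalSubgroup W G : Set G).encard := by
  apply le_antisymm
  · by_contra! hlt
    obtain ⟨t, hts, ht⟩ := Set.exists_subset_encard_eq (Order.add_one_le_of_lt hlt)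
    have htop := (lt_of_lt_of_le hlt le_top).ne
    have hfin : t.Finite := Set.encard_ne_top_iff.1 (by
      rw [ht]; exact WithTop.add_ne_top.2 ⟨htop, ENat.one_ne_top⟩)
    obtain ⟨π, hπ, hinj⟩ := h hfin.toFinset
    rw [hfin.coe_toFinset] at hinj
    have h1 := Set.encard_le_encard_of_injOn (t := (verbalSubgroup W G : Set G)) (fun x hx => by
      rw [← map_verbalSubgroup hπ W]
      exact Subgroup.mem_map_of_mem π (hts hx)) hinj
    rw [ht] at h1
    exact ((ENat.lt_add_one_iff htop).2 le_rfl).not_ge h1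
  · obtain ⟨π, hπ, -⟩ := h ∅
    rw [← map_verbalSubgroup hπ W, Subgroup.coe_map]
    exact Set.encard_image_le _ _

/-! ### Residual properties of finitely generated nilpotent groups -/

/-- By Bézout `z` itself is a `p ^ a`-th power for all `a`; Krull's intersection theorem over ℤ then
gives `c` such that 1 - pc kills `z`. -/
theorem exists_coprime_pow_eq_one {A : Type*} [CommGroup A] [Group.FG A] {p : ℕ} {z : A}
    (h : ∀ a : ℕ, ∃ k : ℕ, k.Coprime p ∧ ∃ y : A, y ^ p ^ a = z ^ k) :
    ∃ k : ℕ, k.Coprime p ∧ z ^ k = 1 := by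
  have : Module.Finite ℤ (Additive A) := Module.Finite.iff_addGroup_fg.mpr inferInstance
  have h1 : Additive.ofMul z ∈ (⨅ i : ℕ, (Ideal.span {(p : ℤ)}) ^ i • ⊤ :
      Submodule ℤ (Additive A)) := by
    rw [Submodule.mem_iInf]
    intro a
    obtain ⟨k, hk, y, hy⟩ := h a
    obtain ⟨u, v, huv⟩ := Nat.isCoprime_iff_coprime.2 (hk.pow_right a)
    have h2 : z = (y ^ u * z ^ v) ^ p ^ a := by
      have h3 : (y ^ u) ^ p ^ a = z ^ (u * (k : ℤ)) := by
        rw [← zpow_natCast (y ^ u), zpow_comm, zpow_natCast, hy, ← zpow_natCast z, ← zpow_mul,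
          mul_comm]
      have h4 : (z ^ v) ^ p ^ a = z ^ (v * ((p ^ a : ℕ) : ℤ)) := by
        rw [← zpow_natCast (z ^ v), ← zpow_mul]
      rw [mul_pow, h3, h4, ← zpow_add, huv, zpow_one]
    have h5 : Additive.ofMul z = (p : ℤ) ^ a • Additive.ofMul (y ^ u * z ^ v) := by
      conv_lhs => rw [h2]
      rw [ofMul_pow, ← Nat.cast_pow, natCast_zsmul]
    rw [h5]
    exact Submodule.smul_mem_smul (Ideal.pow_mem_pow (Ideal.mem_span_singleton_self _) a) trivial
  rw [Ideal.mem_iInf_smul_pow_eq_bot_iff] at h1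
  obtain ⟨⟨r, hr⟩, hrz⟩ := h1
  obtain ⟨c, rfl⟩ := Ideal.mem_span_singleton.1 hr
  refine ⟨(1 - p * c).natAbs, ?_, ?_⟩
  · rw [← Nat.isCoprime_iff_coprime]
    have h6 : IsCoprime (1 - p * c : ℤ) (p : ℤ) := ⟨1, c, by ring⟩
    rcases Int.natAbs_eq (1 - p * c) with h7 | h7
    · rwa [← h7]
    · rw [h7] at h6
      exact IsCoprime.neg_left_iff _ _ |>.1 h6
  · have h8 : z ^ (1 - p * c : ℤ) = 1 := by
      have h9 : z ^ (p * c : ℤ) = z := congrArg Additive.toMul hrz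
      rw [zpow_sub, h9, zpow_one, mul_inv_cancel]
    rcases Int.natAbs_eq (1 - p * c) with h7 | h7
    · rwa [h7, zpow_natCast] at h8
    · rwa [h7, zpow_neg, zpow_natCast, inv_eq_one] at h8

/-- If `x` is central modulo the centre, then [y, x] is central and [y, x]^m = 1, so `x ^ m` is
central: the exponent bound passes to the centre of the central quotient. -/
theorem exists_pow_eq_one_of_center (m : ℕ) (L : Type*) [Group L] [Group.IsNilpotent L] :
    (∀ z ∈ Subgroup.center L, z ^ m = 1) → ∃ a : ℕ, ∀ x : L, x ^ m ^ a = 1 := by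
  refine Group.nilpotent_center_quotient_ind (P := fun L _ _ =>
    (∀ z ∈ Subgroup.center L, z ^ m = 1) → ∃ a : ℕ, ∀ x : L, x ^ m ^ a = 1) L ?_ ?_
  · intro L _ _ _
    exact ⟨0, fun x => Subsingleton.elim _ _⟩
  · intro L _ _ ih h
    obtain ⟨a, ha⟩ := ih (by
      intro z hz
      obtain ⟨x, rfl⟩ := QuotientGroup.mk'_surjective _ z
      rw [← map_pow]
      refine (QuotientGroup.eq_one_iff _).2 (Subgroup.mem_center_iff.2 fun y => ?_)
      have h1 : ⁅y, x⁆ ∈ Subgroup.center L := by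
        rw [← QuotientGroup.eq_one_iff]
        have h2 := Subgroup.mem_center_iff.1 hz (QuotientGroup.mk' _ y)
        rw [← commutatorElement_eq_one_iff_mul_comm, ← map_commutatorElement] at h2
        exact h2
      have h3 : y * x * y⁻¹ = ⁅y, x⁆ * x := by simp [commutatorElement_def]
      have h4 : y * x ^ m * y⁻¹ = x ^ m := by
        rw [← conj_pow, h3, Commute.mul_pow (Subgroup.mem_center_iff.1 h1 x).symm, h _ h1, one_mul]
      exact mul_inv_eq_iff_eq_mul.1 h4)
    refine ⟨a + 1, fun x => ?_⟩
    rw [pow_succ, pow_mul]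
    refine h _ ((QuotientGroup.eq_one_iff _).1 ?_)
    exact ha (QuotientGroup.mk' _ x)

/-- An element without a trivial power of exponent prime to `p` survives in a quotient of `p`-power exponent. -/
theorem exists_normal_pow_mem_notMem {H : Type*} [Group H] [Group.FG H] [Group.IsNilpotent H]
    (p : ℕ) {g : H} (hg : ∀ k : ℕ, k.Coprime p → g ^ k ≠ 1) :
    ∃ N : Subgroup H, N.Normal ∧ g ∉ N ∧ ∃ a : ℕ, ∀ x : H, x ^ p ^ a ∈ N := by
  have := wellFoundedGT_subgroup_of_nilpotent H
  -- Maximality of `N` makes every nontrivial normal subgroup of `H ⧸ N` contain a power of `g` with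
  -- exponent prime to `p`.
  obtain ⟨N, ⟨hN, hgN⟩, hmax⟩ := WellFounded.has_min (wellFounded_gt (α := Subgroup H))
    {N | N.Normal ∧ ∀ k : ℕ, k.Coprime p → g ^ k ∉ N} ⟨⊥, inferInstance, hg⟩
  refine ⟨N, hN, by simpa using hgN 1 (Nat.coprime_one_left p), ?_⟩
  have key : ∀ M : Subgroup (H ⧸ N), M.Normal → M ≠ ⊥ →
      ∃ k : ℕ, k.Coprime p ∧ QuotientGroup.mk' N g ^ k ∈ M := by
    intro M hM hM0
    by_contra! hcon
    refine hmax (M.comap (QuotientGroup.mk' N)) ⟨inferInstance, fun k hk hmem => hcon k hk ?_⟩ ?_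
    · rw [← map_pow]; exact hmem
    · refine lt_of_le_of_ne (fun x hx => ?_) fun he => hM0 ?_
      · change QuotientGroup.mk' N x ∈ M
        rw [QuotientGroup.mk'_apply, (QuotientGroup.eq_one_iff x).2 hx]
        exact M.one_mem
      · have h1 := Subgroup.map_comap_eq_self_of_surjective (QuotientGroup.mk'_surjective N) M
        rw [← h1, ← he]
        exact (Subgroup.map_eq_bot_iff _).2 (QuotientGroup.ker_mk' N).ge
  -- Otherwise the `p ^ a`-th powers in the centre are nontrivial for all `a`, so each such subgroup
  -- contains a power of `g` prime to `p`; the Krull argument then kills such a power, against the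
  -- choice of `N`.
  have hcenter : ∃ a : ℕ, ∀ z ∈ Subgroup.center (H ⧸ N), z ^ p ^ a = 1 := by
    by_contra! hcon
    let _ := commGroupOfLeCenter (le_refl (Subgroup.center (H ⧸ N)))
    have := wellFoundedGT_subgroup_of_nilpotent (H ⧸ N)
    have : Group.FG (Subgroup.center (H ⧸ N)) :=
      (Group.fg_iff_subgroup_fg _).2 (Subgroup.fg_of_wellFoundedGT _)
    have h1 : ∀ a : ℕ, ∃ k : ℕ, k.Coprime p ∧ ∃ y : Subgroup.center (H ⧸ N),
        (y : H ⧸ N) ^ p ^ a = QuotientGroup.mk' N g ^ k := by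
      intro a
      let M : Subgroup (H ⧸ N) := (powMonoidHom (α := Subgroup.center (H ⧸ N)) (p ^ a)).range.map
        (Subgroup.center (H ⧸ N)).subtype
      obtain ⟨k, hk, _, ⟨y, rfl⟩, hy⟩ := key M
        (normal_of_le_center (Subgroup.map_subtype_le _)) (by
          obtain ⟨z, hz, hz1⟩ := hcon a
          intro hM
          have h2 : z ^ p ^ a ∈ M := ⟨_, ⟨⟨z, hz⟩, rfl⟩, rfl⟩
          rw [hM] at h2
          exact hz1 (Subgroup.mem_bot.1 h2))
      exact ⟨k, hk, y, hy⟩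
    obtain ⟨k₀, hk₀, z, hz⟩ := h1 0
    rw [pow_zero, pow_one] at hz
    obtain ⟨k, hk, hzk⟩ := exists_coprime_pow_eq_one (p := p) (z := z) (by
      intro a
      obtain ⟨k, hk, y, hy⟩ := h1 a
      refine ⟨k, hk, y ^ k₀, Subtype.ext ?_⟩
      change ((y : H ⧸ N) ^ k₀) ^ p ^ a = (z : H ⧸ N) ^ k
      rw [← pow_mul, mul_comm, pow_mul, hy, hz, ← pow_mul, ← pow_mul, mul_comm])
    have h2 : (z : H ⧸ N) ^ k = 1 := congrArg Subtype.val hzk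
    rw [hz, ← pow_mul, ← map_pow] at h2
    exact hgN _ (hk₀.mul_left hk) ((QuotientGroup.eq_one_iff _).1 h2)
  obtain ⟨a, ha⟩ := hcenter
  obtain ⟨b, hb⟩ := exists_pow_eq_one_of_center (p ^ a) (H ⧸ N) ha
  refine ⟨a * b, fun x => (QuotientGroup.eq_one_iff _).1 ?_⟩
  rw [pow_mul]
  exact hb (QuotientGroup.mk' N x)

theorem isOfFinOrder_of_mk_torsionSubgroup {H : Type*} [Group H] [Group.IsNilpotent H] {g : H}
    (hg : IsOfFinOrder (QuotientGroup.mk' (torsionSubgroup H) g)) : IsOfFinOrder g := by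
  obtain ⟨k, hk, hk1⟩ := isOfFinOrder_iff_pow_eq_one.1 hg
  rw [← map_pow] at hk1
  have h1 : g ^ k ∈ torsionSubgroup H := (QuotientGroup.eq_one_iff _).1 hk1
  exact IsOfFinOrder.of_pow h1 hk.ne'

/-- An element of infinite order survives in a quotient of `p`-power exponent in which the torsion
is killed. -/
theorem exists_normal_pow_mem_notMem_of_not_isOfFinOrder {H : Type*} [Group H] [Group.FG H]
    [Group.IsNilpotent H] {p : ℕ} (hp : p.Prime) {g : H} (hg : ¬ IsOfFinOrder g) :
    ∃ N : Subgroup H, N.Normal ∧ torsionSubgroup H ≤ N ∧ g ∉ N ∧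
      ∃ a : ℕ, ∀ x : H, x ^ p ^ a ∈ N := by
  obtain ⟨N, hN, hgN, a, ha⟩ := exists_normal_pow_mem_notMem (H := H ⧸ torsionSubgroup H) p
    (g := QuotientGroup.mk' _ g) (fun k hk h => by
      refine hg (isOfFinOrder_of_mk_torsionSubgroup (isOfFinOrder_iff_pow_eq_one.2 ⟨k, ?_, h⟩))
      rcases Nat.eq_zero_or_pos k with rfl | h0
      · exact absurd ((Nat.coprime_zero_left p).1 hk) hp.one_lt.ne'
      · exact h0)
  refine ⟨N.comap (QuotientGroup.mk' _), inferInstance, fun x hx => ?_, hgN, a, fun x => ?_⟩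
  · change QuotientGroup.mk' _ x ∈ N
    rw [QuotientGroup.mk'_apply, (QuotientGroup.eq_one_iff x).2 hx]
    exact N.one_mem
  · exact ha (QuotientGroup.mk' _ x)

/-! ### Generation of nilpotent groups and the Chinese remainder theorem -/

/-- A Frattini argument: a proper `M ⊔ N` would lie in a maximal subgroup `K`, normal by nilpotency,
whose quotient has exponent dividing `q`. The hypothesis on `M` says that `M` generates modulo
`q`-th powers. -/
theorem sup_eq_top_of_pow_mem {H : Type*} [Group H] [Group.FG H] [Group.IsNilpotent H]
    {M N : Subgroup H} {q a : ℕ}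
    (hM : ∀ K : Subgroup H, K.Normal → M ≤ K → (∀ x : H, x ^ q ∈ K) → K = ⊤)
    (hN : ∀ x : H, x ^ q ^ a ∈ N) : M ⊔ N = ⊤ := by
  have := wellFoundedGT_subgroup_of_nilpotent H
  by_contra hne
  obtain ⟨K, hK, hle⟩ := (IsCoatomic.eq_top_or_exists_le_coatom (M ⊔ N)).resolve_left hne
  have hKn : K.Normal :=
    Subgroup.NormalizerCondition.normal_of_coatom K Group.normalizerCondition_of_isNilpotent hK
  refine hK.1 (hM K hKn (le_sup_left.trans hle) ?_)
  have hKp : ∀ b, ∀ x : H, x ^ q ^ b ∈ K → x ∈ K ∨ ∃ y : H, y ∉ K ∧ y ^ q ∈ K := by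
    intro b
    induction b with
    | zero => intro x hx; left; simpa using hx
    | succ b ih =>
      intro x hx
      by_cases hxb : x ^ q ^ b ∈ K
      · exact ih x hxb
      · right
        exact ⟨_, hxb, by rwa [← pow_mul, ← pow_succ]⟩
  obtain ⟨x, hx⟩ : ∃ x, x ∉ K := by
    by_contra! h
    exact hK.1 (Subgroup.eq_top_iff' K |>.2 h)
  obtain ⟨y, hy, hyq⟩ := (hKp a x ((le_sup_right.trans hle) (hN x))).resolve_left hx
  have htop : K ⊔ Subgroup.zpowers y = ⊤ := hK.2 _ (lt_of_le_of_ne le_sup_left fun he => hy (by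
    rw [he]
    exact Subgroup.mem_sup_right (Subgroup.mem_zpowers y)))
  intro z
  have hz : z ∈ K ⊔ Subgroup.zpowers y := htop ▸ Subgroup.mem_top z
  rw [Subgroup.mem_sup_of_normal_left] at hz
  obtain ⟨k, hk, _, ⟨i, rfl⟩, rfl⟩ := hz
  rw [← QuotientGroup.eq_one_iff] at hk hyq ⊢
  rw [QuotientGroup.mk_pow, QuotientGroup.mk_mul, hk, one_mul, QuotientGroup.mk_zpow,
    ← zpow_natCast, zpow_comm, zpow_natCast, ← QuotientGroup.mk_pow, hyq, one_zpow]

/-- Chinese remainder theorem by Bézout exponents. Modulo each `N j` one of the two factors dies, so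
no commutativity is needed, and the solution stays in `M`. -/
theorem exists_mem_congruent {H κ : Type*} [Group H] [Fintype κ] (M : Subgroup H) (m : κ → ℕ)
    (hm : Pairwise fun j k => (m j).Coprime (m k)) (N : κ → Subgroup H) [∀ k, (N k).Normal]
    (hN : ∀ k x, x ^ m k ∈ N k) (h : κ → H) (hM : ∀ k, h k ∈ M) :
    ∃ y ∈ M, ∀ k, QuotientGroup.mk' (N k) y = QuotientGroup.mk' (N k) (h k) := by
  classical
  have hN' : ∀ k x, QuotientGroup.mk' (N k) x ^ m k = 1 := fun k x =>
    (QuotientGroup.eq_one_iff _).2 (hN k x)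
  suffices ∀ F : Finset κ, ∃ y ∈ M, ∀ k ∈ F,
      QuotientGroup.mk' (N k) y = QuotientGroup.mk' (N k) (h k) by
    obtain ⟨y, hy, hyF⟩ := this Finset.univ
    exact ⟨y, hy, fun k => hyF k (Finset.mem_univ k)⟩
  intro F
  induction F using Finset.induction_on with
  | empty => exact ⟨1, M.one_mem, by simp⟩
  | insert k F hk ih =>
    obtain ⟨y, hy, hyF⟩ := ih
    have hcop : (∏ j ∈ F, m j).Coprime (m k) :=
      Nat.Coprime.prod_left fun j hj => hm (fun h => hk (h ▸ hj))
    obtain ⟨u, v, huv⟩ := Nat.isCoprime_iff_coprime.2 hcop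
    have hzero : ∀ (j : κ) (x : H) (c : ℤ), (m j : ℤ) ∣ c → QuotientGroup.mk' (N j) x ^ c = 1 := by
      rintro j x _ ⟨d, rfl⟩
      rw [zpow_mul, zpow_natCast, hN', one_zpow]
    have hone : ∀ (j : κ) (x : H) (c d : ℤ), c + d = 1 → (m j : ℤ) ∣ d →
        QuotientGroup.mk' (N j) x ^ c = QuotientGroup.mk' (N j) x := by
      intro j x c d hcd hd
      rw [eq_sub_of_add_eq hcd, zpow_sub, hzero j x d hd, zpow_one, inv_one, mul_one]
    refine ⟨y ^ (v * m k) * h k ^ (u * (∏ j ∈ F, m j : ℕ)),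
      M.mul_mem (M.zpow_mem hy _) (M.zpow_mem (hM k) _), fun j hj => ?_⟩
    rw [map_mul, map_zpow, map_zpow]
    rcases Finset.mem_insert.1 hj with rfl | hj
    · rw [hzero j y _ (dvd_mul_left _ _), hone j _ _ _ huv (dvd_mul_left _ _), one_mul]
    · have hdvd : (m j : ℤ) ∣ u * (∏ j ∈ F, m j : ℕ) :=
        dvd_mul_of_dvd_right (Int.natCast_dvd_natCast.2 (Finset.dvd_prod_of_mem m hj)) _
      rw [hzero j (h k) _ hdvd, hone j y _ _ ((add_comm _ _).trans huv) hdvd, mul_one, hyF j hj]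

theorem lift_mem_iff_of_congruent {ι H : Type*} [Group H] (N : Subgroup H) [N.Normal]
    {s t : ι → H} (h : ∀ i, QuotientGroup.mk' N (s i) = QuotientGroup.mk' N (t i))
    (w : FreeGroup ι) : FreeGroup.lift s w ∈ N ↔ FreeGroup.lift t w ∈ N := by
  rw [← QuotientGroup.eq_one_iff, ← QuotientGroup.eq_one_iff, ← QuotientGroup.mk'_apply,
    ← QuotientGroup.mk'_apply, ← lift_mk_comp, ← lift_mk_comp, funext h]

/-! ### Generic generating families -/

/-- Each word `w` gets two primes. The first half `s` of the tuple imitates a good value at one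
prime and the generators `x` at the other. The second half is `x i * y i` with `y i` in the subgroup
generated by `s`, so the tuple generates whatever `y` is, and `y` can be adjusted at the second
primes. -/
theorem exists_generating_lift_ne_one {ι H : Type*} [Group H] [Group.FG H] [Group.IsNilpotent H]
    {x : ι → H} (hx : Subgroup.closure (Set.range x) = ⊤) (F : Finset (FreeGroup (ι ⊕ ι)))
    (hF : ∀ w ∈ F, ∃ h : ι ⊕ ι → H, ¬ IsOfFinOrder (FreeGroup.lift h w)) :
    ∃ S : ι ⊕ ι → H, Subgroup.closure (Set.range S) = ⊤ ∧ ∀ w ∈ F, FreeGroup.lift S w ≠ 1 := by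
  classical
  obtain ⟨P, hP, hPinj⟩ : ∃ P : F ⊕ F → ℕ, (∀ k, (P k).Prime) ∧ Function.Injective P := by
    refine ⟨fun k => Nat.nth Nat.Prime (Fintype.equivFin (F ⊕ F) k), fun k =>
      Nat.prime_nth_prime _, fun j k hjk => ?_⟩
    exact (Fintype.equivFin (F ⊕ F)).injective (Fin.ext
      (Nat.nth_injective Nat.infinite_setOfPred_prime hjk))
  have hcop : ∀ {j k : F ⊕ F}, j ≠ k → (P j).Coprime (P k) := fun h =>
    (Nat.coprime_primes (hP _) (hP _)).2 (hPinj.ne h)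
  choose h hh using fun w : F => hF w w.2
  choose N hN hNtors hNmem a ha using fun w : F =>
    exists_normal_pow_mem_notMem_of_not_isOfFinOrder (hP (Sum.inl w)) (hh w)
  let N₁ : F ⊕ F → Subgroup H :=
    Sum.elim N fun w => Subgroup.normalClosure (Set.range fun y : H => y ^ P (Sum.inr w))
  have hN₁ : ∀ k, (N₁ k).Normal := by
    rintro (w | w)
    · exact hN w
    · exact Subgroup.normalClosure_normal
  let m₁ : F ⊕ F → ℕ := Sum.elim (fun w => P (Sum.inl w) ^ a w) fun w => P (Sum.inr w)
  have hm₁ : Pairwise fun j k => (m₁ j).Coprime (m₁ k) := by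
    rintro (v | v) (w | w) hvw
    · exact (hcop hvw).pow _ _
    · exact (hcop hvw).pow_left _
    · exact (hcop hvw).pow_right _
    · exact hcop hvw
  have hpow₁ : ∀ k y, y ^ m₁ k ∈ N₁ k := by
    rintro (w | w) y
    · exact ha w y
    · exact Subgroup.subset_normalClosure ⟨y, rfl⟩
  choose s _ hs using fun i : ι => exists_mem_congruent ⊤ m₁ hm₁ N₁ hpow₁
    (Sum.elim (fun w => h w (Sum.inl i)) fun _ => x i) fun _ => Subgroup.mem_top _
  set M := Subgroup.closure (Set.range s)
  -- The order stays infinite, and not merely the value nontrivial, because `N w` contains the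
  -- torsion; this allows passing to the second prime.
  have hnotfin : ∀ w : F, ¬ IsOfFinOrder
      (FreeGroup.lift (Sum.elim s fun i => h w (Sum.inr i)) (w : FreeGroup (ι ⊕ ι))) := by
    intro w hfin
    refine hNmem w ((lift_mem_iff_of_congruent (N w) ?_ _).1 (hNtors w hfin))
    rintro (i | i)
    · exact hs i (Sum.inl w)
    · rfl
  choose N₂ hN₂ _ hNmem₂ b hb using fun w : F =>
    exists_normal_pow_mem_notMem_of_not_isOfFinOrder (hP (Sum.inr w)) (hnotfin w)
  -- `s` agrees with `x` modulo `q`-th powers for the second prime `q`, so `M` maps onto every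
  -- quotient of `q`-power exponent.
  have hsup : ∀ w : F, N₂ w ⊔ M = ⊤ := by
    intro w
    rw [sup_comm]
    refine sup_eq_top_of_pow_mem (fun K hK hMK hKq => ?_) (hb w)
    have hle : Subgroup.normalClosure (Set.range fun y : H => y ^ P (Sum.inr w)) ≤ K :=
      Subgroup.normalClosure_le_normal (by rintro _ ⟨y, rfl⟩; exact hKq y)
    rw [eq_top_iff, ← hx, Subgroup.closure_le]
    rintro _ ⟨i, rfl⟩
    have h1 : (s i)⁻¹ * x i ∈ K := hle (QuotientGroup.eq.1 (hs i (Sum.inr w)))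
    have h2 : s i ∈ K := hMK (Subgroup.subset_closure ⟨i, rfl⟩)
    simpa using K.mul_mem h2 h1
  have hcos : ∀ (w : F) (i : ι), ∃ z ∈ M,
      QuotientGroup.mk' (N₂ w) z = QuotientGroup.mk' (N₂ w) ((x i)⁻¹ * h w (Sum.inr i)) := by
    intro w i
    have h1 : (x i)⁻¹ * h w (Sum.inr i) ∈ N₂ w ⊔ M := hsup w ▸ Subgroup.mem_top _
    rw [Subgroup.mem_sup_of_normal_left] at h1
    obtain ⟨y, hy, z, hz, hyz⟩ := h1
    refine ⟨z, hz, ?_⟩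
    have h2 : QuotientGroup.mk' (N₂ w) y = 1 := (QuotientGroup.eq_one_iff _).2 hy
    rw [← hyz, map_mul, h2, one_mul]
  choose z hzM hz using hcos
  choose y hyM hy using fun i : ι => exists_mem_congruent M (fun w => P (Sum.inr w) ^ b w)
    (fun v w hvw => (hcop (Sum.inr_injective.ne hvw)).pow _ _) N₂ hb (fun w => z w i)
    fun w => hzM w i
  refine ⟨Sum.elim s fun i => x i * y i, ?_, fun w hw h1 => ?_⟩
  · have hMle : M ≤ Subgroup.closure (Set.range (Sum.elim s fun i => x i * y i)) :=
      Subgroup.closure_mono (by rintro _ ⟨i, rfl⟩; exact ⟨Sum.inl i, rfl⟩)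
    rw [eq_top_iff, ← hx, Subgroup.closure_le]
    rintro _ ⟨i, rfl⟩
    have h2 : x i * y i ∈ Subgroup.closure (Set.range (Sum.elim s fun i => x i * y i)) :=
      Subgroup.subset_closure ⟨Sum.inr i, rfl⟩
    simpa using Subgroup.mul_mem _ h2 (Subgroup.inv_mem _ (hMle (hyM i)))
  · refine hNmem₂ ⟨w, hw⟩ ((lift_mem_iff_of_congruent (N₂ ⟨w, hw⟩) ?_ w).1
      (h1 ▸ (N₂ ⟨w, hw⟩).one_mem : FreeGroup.lift (Sum.elim s fun i => x i * y i) w ∈ _))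
    rintro (i | i)
    · rfl
    · change QuotientGroup.mk' (N₂ ⟨w, hw⟩) (x i * y i) = QuotientGroup.mk' _ (h ⟨w, hw⟩ (Sum.inr i))
      rw [map_mul, hy i ⟨w, hw⟩, hz, ← map_mul, mul_inv_cancel_left]

/-! ### Relatively free groups -/

/-- The identities in the letters `κ` of the group `G`. -/
def identitySubgroup (κ G : Type*) [Group G] : Subgroup (FreeGroup κ) :=
  ⨅ h : κ → G, (FreeGroup.lift h).ker

theorem mem_identitySubgroup {κ G : Type*} [Group G] {w : FreeGroup κ} :
    w ∈ identitySubgroup κ G ↔ ∀ h : κ → G, FreeGroup.lift h w = 1 := by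
  simp [identitySubgroup, Subgroup.mem_iInf, MonoidHom.mem_ker]

instance identitySubgroup_normal (κ G : Type*) [Group G] : (identitySubgroup κ G).Normal :=
  Subgroup.normal_iInf_normal fun _ => inferInstance

theorem lift_map {κ ι G : Type*} [Group G] (e : κ → ι) (g : ι → G) (w : FreeGroup κ) :
    FreeGroup.lift g (FreeGroup.map e w) = FreeGroup.lift (fun k => g (e k)) w := by
  have : FreeGroup.lift (fun k => g (e k)) = (FreeGroup.lift g).comp (FreeGroup.map e) := by
    ext k; simp
  rw [this, MonoidHom.comp_apply]

theorem mem_identitySubgroup_iff_map_mem_identities {κ K : Type*} [Group K] {e : κ → ℕ}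
    (he : Function.Injective e) (w : FreeGroup κ) :
    w ∈ identitySubgroup κ K ↔ FreeGroup.map e w ∈ identities K := by
  rw [mem_identitySubgroup]
  constructor
  · intro hw g
    rw [lift_map]
    exact hw _
  · intro hw f
    have h1 := hw (Function.extend e f 1)
    rw [lift_map] at h1
    simpa [he.extend_apply] using h1

/-- Countably many letters embed into ℕ, and assignments extend by 1 to the remaining letters. -/
theorem identitySubgroup_eq_of_identities_eq (κ : Type*) [Countable κ] {G H : Type*} [Group G]
    [Group H] (h : identities G = identities H) :
    identitySubgroup κ G = identitySubgroup κ H := by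
  obtain ⟨e, he⟩ := Countable.exists_injective_nat κ
  ext w
  rw [mem_identitySubgroup_iff_map_mem_identities he,
    mem_identitySubgroup_iff_map_mem_identities he, h]

/-- A finitely generated nilpotent group whose torsion-free quotient satisfies the same identities
preforms the relatively free groups of large rank. -/
theorem preforms_relativelyFree {ι H : Type u} [Fintype ι] [Group H] [Nontrivial H] [Group.FG H]
    [Group.IsNilpotent H] (hH : identities (H ⧸ torsionSubgroup H) = identities H)
    {x : ι → H} (hx : Subgroup.closure (Set.range x) = ⊤) :
    Preforms H (FreeGroup (ι ⊕ ι) ⧸ identitySubgroup (ι ⊕ ι) H) := by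
  classical
  set N := identitySubgroup (ι ⊕ ι) H with hN
  let t : ι ⊕ ι → FreeGroup (ι ⊕ ι) ⧸ N := fun i => QuotientGroup.mk' N (FreeGroup.of i)
  have ht : ∀ w, FreeGroup.lift t w = QuotientGroup.mk' N w := fun w => by
    have := lift_mk_comp N (FreeGroup.of : ι ⊕ ι → _) w
    rwa [FreeGroup.lift_of_eq_id] at this
  refine IsMarkedLimit.preforms (t := t) ?_ ?_ fun F => ?_
  · intro i j hij
    by_contra hne
    obtain ⟨g, hg⟩ := exists_ne (1 : H)
    have h1 := mem_identitySubgroup.1 (QuotientGroup.eq.1 hij) (Pi.mulSingle j g)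
    rw [map_mul, map_inv, FreeGroup.lift_apply_of, FreeGroup.lift_apply_of, Pi.mulSingle_eq_same,
      Pi.mulSingle_eq_of_ne hne, inv_one, one_mul] at h1
    exact hg h1
  · exact closure_range_mk N (FreeGroup.closure_range_of _)
  -- Identities hold at every tuple, so only non-identities need care. They are also non-identities
  -- of the torsion-free quotient, and a nontrivial value there lifts to one of infinite order.
  · obtain ⟨S, hS, hSF⟩ := exists_generating_lift_ne_one hx (F.filter fun w => w ∉ N) (by
      intro w hw
      have hwN := (Finset.mem_filter.1 hw).2
      rw [hN, ← identitySubgroup_eq_of_identities_eq (ι ⊕ ι) hH, mem_identitySubgroup] at hwN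
      push Not at hwN
      obtain ⟨h, hh⟩ := hwN
      choose h' hh' using fun i => QuotientGroup.mk'_surjective (torsionSubgroup H) (h i)
      refine ⟨h', fun hfin => hh ?_⟩
      rw [← funext hh', lift_mk_comp]
      exact (QuotientGroup.eq_one_iff _).2 hfin)
    refine ⟨S, hS, fun w hw => ?_⟩
    rw [ht, QuotientGroup.mk'_apply, QuotientGroup.eq_one_iff]
    constructor
    · intro h1
      by_contra h2
      exact hSF w (Finset.mem_filter.2 ⟨hw, h2⟩) h1
    · intro h1
      exact mem_identitySubgroup.1 h1 S

/-! ### Groups generating a nilpotent variety -/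

theorem isNilpotent_of_identities_eq {G H : Type u} [Group G] [Group H] [Group.FG H]
    [Group.IsNilpotent G] (h : identities H = identities G) : Group.IsNilpotent H := by
  obtain ⟨n, hn⟩ := exists_commWords_trivial G
  obtain ⟨ι, _, s, hs⟩ := exists_generating_family H
  refine Subgroup.nilpotent_iff_lowerCentralSeries.2
    ⟨n, lowerCentralSeries_eq_bot_of_commWords n hs fun w hw => ?_⟩
  have h1 : w ∈ identitySubgroup ι G := mem_identitySubgroup.2 fun g => hn g w hw
  rw [← identitySubgroup_eq_of_identities_eq ι h] at h1
  exact mem_identitySubgroup.1 h1 s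

theorem subsingleton_of_identities_eq {G H : Type*} [Group G] [Group H] [Subsingleton G]
    (h : identities H = identities G) : Subsingleton H := by
  have h1 : FreeGroup.of 0 ∈ identities H := h ▸ fun g => Subsingleton.elim _ _
  have h2 : ∀ x : H, x = 1 := fun x => by simpa using h1 fun _ => x
  exact ⟨fun x y => (h2 x).trans (h2 y).symm⟩

theorem identities_subset_quotient {G : Type*} [Group G] (N : Subgroup G) [N.Normal] :
    identities G ⊆ identities (G ⧸ N) :=
  identities_subset_of_surjective (QuotientGroup.mk'_surjective N)

/-- Whether the torsion-free quotient satisfies further identities depends only on the variety. -/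
theorem identities_quotient_torsionSubgroup_eq {G H : Type*} [Group G] [Group H]
    [Group.IsNilpotent G] [Group.IsNilpotent H] [Group.FG H] (h : identities H = identities G)
    (hG : identities (G ⧸ torsionSubgroup G) = identities G) :
    identities (H ⧸ torsionSubgroup H) = identities H := by
  refine subset_antisymm (fun w hw => ?_) (identities_subset_quotient _)
  have := finite_torsionSubgroup H
  -- This power is thereby an identity of `G ⧸ torsionSubgroup G`, where absence of torsion lets one
  -- extract the root.
  have h1 : w ^ Nat.card (torsionSubgroup H) ∈ identities H := by
    intro x
    have h2 := hw fun i => QuotientGroup.mk' _ (x i)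
    rw [lift_mk_comp] at h2
    have h3 : FreeGroup.lift x w ∈ torsionSubgroup H := (QuotientGroup.eq_one_iff _).1 h2
    rw [map_pow]
    exact congrArg Subtype.val (pow_card_eq_one' (x := (⟨_, h3⟩ : torsionSubgroup H)))
  rw [h, ← hG] at h1
  rw [h, ← hG]
  intro g
  have h4 := h1 g
  rw [map_pow] at h4
  obtain ⟨y, hy⟩ := QuotientGroup.mk'_surjective _ (FreeGroup.lift g w)
  have h5 : IsOfFinOrder (FreeGroup.lift g w) :=
    isOfFinOrder_iff_pow_eq_one.2 ⟨_, Nat.card_pos, h4⟩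
  rw [← hy] at h5 ⊢
  exact (QuotientGroup.eq_one_iff _).2 (isOfFinOrder_of_mk_torsionSubgroup h5)

/-! ### Powers of a group -/

theorem lift_apply_pi {κ ι G : Type*} [Group G] (g : ι → κ → G) (w : FreeGroup ι) (k : κ) :
    FreeGroup.lift g w k = FreeGroup.lift (fun i => g i k) w :=
  map_lift (Pi.evalMonoidHom (fun _ : κ => G) k) g w

theorem identities_pi (κ G : Type*) [Nonempty κ] [Group G] :
    identities (κ → G) = identities G := by
  refine subset_antisymm (identities_subset_of_surjective
    (π := Pi.evalMonoidHom (fun _ : κ => G) (Classical.arbitrary κ))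
    (Function.surjective_eval _)) fun w hw g => ?_
  funext k
  rw [lift_apply_pi]
  exact hw _

/-- Evaluating at tuples supported on one coordinate yields each factor; finitely many factors
generate the product. -/
theorem verbalSubgroup_pi (κ G : Type*) [Finite κ] [Group G] (W : Set (FreeGroup ℕ)) :
    verbalSubgroup W (κ → G) = Subgroup.pi Set.univ fun _ => verbalSubgroup W G := by
  classical
  apply le_antisymm
  · rw [verbalSubgroup, Subgroup.closure_le]
    rintro _ ⟨w, hw, g, rfl⟩ k -
    rw [lift_apply_pi]
    exact Subgroup.subset_closure ⟨w, hw, _, rfl⟩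
  · rw [Subgroup.pi_le_iff]
    intro k
    rw [verbalSubgroup, MonoidHom.map_closure, Subgroup.closure_le]
    rintro _ ⟨_, ⟨w, hw, g, rfl⟩, rfl⟩
    exact Subgroup.subset_closure ⟨w, hw, _,
      (map_lift (MonoidHom.mulSingle (fun _ : κ => G) k) g w).symm⟩

/-- The verbal subgroup of a power is the power of the verbal subgroup. -/
def verbalSubgroupPiEquiv (κ G : Type*) [Finite κ] [Group G] (W : Set (FreeGroup ℕ)) :
    verbalSubgroup W (κ → G) ≃ (κ → verbalSubgroup W G) where
  toFun x k := ⟨(x : κ → G) k, (verbalSubgroup_pi κ G W ▸ x.2 :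
    (x : κ → G) ∈ Subgroup.pi Set.univ fun _ => verbalSubgroup W G) k trivial⟩
  invFun y := ⟨fun k => y k, verbalSubgroup_pi κ G W ▸ fun k _ => (y k).2⟩
  left_inv _ := rfl
  right_inv _ := rfl

theorem verbalSubgroup_eq_bot_iff {G : Type*} [Group G] {W : Set (FreeGroup ℕ)} :
    verbalSubgroup W G = ⊥ ↔ W ⊆ identities G := by
  rw [verbalSubgroup, Subgroup.closure_eq_bot_iff]
  constructor
  · intro h w hw g
    exact h ⟨w, hw, g, rfl⟩
  · rintro h _ ⟨w, hw, g, rfl⟩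
    exact h hw g

theorem verbalSubgroup_identities_quotient_le {G : Type*} [Group G] (N : Subgroup G) [N.Normal] :
    verbalSubgroup (identities (G ⧸ N)) G ≤ N := by
  rw [verbalSubgroup, Subgroup.closure_le]
  rintro _ ⟨w, hw, g, rfl⟩
  have h1 := hw fun i => QuotientGroup.mk' N (g i)
  rw [lift_mk_comp] at h1
  exact (QuotientGroup.eq_one_iff _).1 h1

/-! ### Connected components -/

namespace FGGroupClass

theorem reachable_of_preforms {A B : Type u} [Group A] [Group B] [Group.FG A] [Group.FG B]
    (h : _root_.Preforms A B) : graph.Reachable (of A) (of B) := by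
  by_cases he : of A = of B
  · rw [he]
  · exact SimpleGraph.Adj.reachable ((SimpleGraph.fromRel_adj _ _ _).2 ⟨he, Or.inl h⟩)

theorem exists_eq_of (a : FGGroupClass.{u}) :
    ∃ (A : Type u) (_ : Group A) (_ : Group.FG A), a = of A := by
  obtain ⟨A, rfl⟩ := Quotient.exists_rep a
  exact ⟨A.carrier, A.group, A.fg, rfl⟩

/-- Identities and cardinalities of verbal subgroups are constant on the connected component of a
nilpotent group. -/
theorem invariants_of_component_eq {A B : Type u} [Group A] [Group B] [Group.FG A] [Group.FG B]
    [Group.IsNilpotent A] (h : component A = component B) :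
    Group.IsNilpotent B ∧ _root_.identities B = _root_.identities A ∧
      ∀ W : Set (FreeGroup ℕ), (verbalSubgroup W B : Set B).encard =
        (verbalSubgroup W A : Set A).encard := by
  obtain ⟨p⟩ := SimpleGraph.ConnectedComponent.eq.1 h
  -- The endpoints become arbitrary classes with representatives, so that induction on the walk
  -- applies.
  suffices ∀ {a b : FGGroupClass.{u}} (_ : graph.Walk a b) {A : Type u} [Group A] [Group.FG A]
      [Group.IsNilpotent A], a = of A → ∀ {B : Type u} [Group B] [Group.FG B], b = of B →
      Group.IsNilpotent B ∧ _root_.identities B = _root_.identities A ∧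
        ∀ W : Set (FreeGroup ℕ), (verbalSubgroup W B : Set B).encard =
          (verbalSubgroup W A : Set A).encard from this p rfl rfl
  clear p h
  intro a b p
  induction p with
  | nil =>
    intro A _ _ _ hA B _ _ hB
    obtain ⟨e⟩ : Nonempty (A ≃* B) := Quotient.exact (hA.symm.trans hB)
    have he := e.symm.hasSeparatingSurjections
    exact ⟨Group.nilpotent_of_mulEquiv e, he.identities_eq, he.encard_verbalSubgroup⟩
  | @cons _ c _ hadj _ ih =>
    rintro A _ _ _ rfl B _ _ hB
    obtain ⟨C, _, _, rfl⟩ := exists_eq_of c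
    obtain ⟨-, hAC⟩ := (SimpleGraph.fromRel_adj _ _ _).1 hadj
    have key : Group.IsNilpotent C ∧ _root_.identities C = _root_.identities A ∧
        ∀ W : Set (FreeGroup ℕ), (verbalSubgroup W C : Set C).encard =
          (verbalSubgroup W A : Set A).encard := by
      rcases hAC with hAC | hAC
      · have hAC : _root_.Preforms A C := hAC
        have hC := (isNilpotent_iff_of_preforms hAC).1 inferInstance
        have hs := hAC.hasSeparatingSurjections
        exact ⟨hC, hs.identities_eq, hs.encard_verbalSubgroup⟩
      · have hAC : _root_.Preforms C A := hAC
        have hs := hAC.hasSeparatingSurjections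
        exact ⟨(isNilpotent_iff_of_preforms hAC).2 inferInstance, hs.identities_eq.symm,
          fun W => (hs.encard_verbalSubgroup W).symm⟩
    obtain ⟨hC, h1, h2⟩ := key
    obtain ⟨h3, h4, h5⟩ := ih (A := C) rfl hB
    exact ⟨h3, h4.trans h1, fun W => (h5 W).trans (h2 W)⟩

theorem supp_component_subset (A : Type u) [Group A] [Group.FG A] [Group.IsNilpotent A] :
    (component A).supp ⊆ generators (_root_.identities A) := by
  intro b hb
  obtain ⟨B, _, _, rfl⟩ := exists_eq_of b
  exact (invariants_of_component_eq (A := A) (B := B) (Eq.symm hb)).2.1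

/-- Both groups preform one relatively free group: generating families padded with 1 share the index
type `ι ⊕ κ`. The trivial variety is separate, since the free letters would coincide. -/
theorem generators_subset_supp_component (G : Type u) [Group G] [Group.FG G] [Group.IsNilpotent G]
    (hG : _root_.identities (G ⧸ torsionSubgroup G) = _root_.identities G) :
    generators (_root_.identities G) ⊆ (component G).supp := by
  intro b hb
  obtain ⟨H, _, _, rfl⟩ := exists_eq_of b
  have hid : _root_.identities H = _root_.identities G := hb
  refine SimpleGraph.ConnectedComponent.eq.2 ?_
  rcases subsingleton_or_nontrivial G with _ | _
  · have := subsingleton_of_identities_eq hid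
    have he : of H = of G := by
      have : Unique H := uniqueOfSubsingleton 1
      have : Unique G := uniqueOfSubsingleton 1
      exact Quotient.sound ⟨(MulEquiv.ofUnique : H ≃* G)⟩
    rw [he]
  · have := isNilpotent_of_identities_eq hid
    have : Nontrivial H := by
      rw [← not_subsingleton_iff_nontrivial]
      intro _
      exact not_subsingleton G (subsingleton_of_identities_eq hid.symm)
    obtain ⟨ι, _, s, hs⟩ := exists_generating_family G
    obtain ⟨κ, _, t, ht⟩ := exists_generating_family H
    have hs' : Subgroup.closure (Set.range (Sum.elim s fun _ : κ => (1 : G))) = ⊤ := by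
      rw [eq_top_iff, ← hs]
      exact Subgroup.closure_mono (by rintro _ ⟨i, rfl⟩; exact ⟨Sum.inl i, rfl⟩)
    have ht' : Subgroup.closure (Set.range (Sum.elim (fun _ : ι => (1 : H)) t)) = ⊤ := by
      rw [eq_top_iff, ← ht]
      exact Subgroup.closure_mono (by rintro _ ⟨i, rfl⟩; exact ⟨Sum.inr i, rfl⟩)
    have h1 := preforms_relativelyFree hG hs'
    have h2 := preforms_relativelyFree (identities_quotient_torsionSubgroup_eq hid hG) ht'
    have h3 := h2.congr (MulEquiv.refl H)
      (QuotientGroup.quotientMulEquivOfEq (identitySubgroup_eq_of_identities_eq _ hid))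
    exact (reachable_of_preforms h3).trans (reachable_of_preforms h1).symm

theorem mem_generators_pi (G : Type u) [Group G] [Group.FG G] {n : ℕ} (hn : 1 ≤ n) :
    of (Fin n → G) ∈ generators (_root_.identities G) := by
  have : Nonempty (Fin n) := ⟨⟨0, hn⟩⟩
  exact identities_pi (Fin n) G

theorem card_verbalSubgroup_ne {G : Type u} [Group G] {W : Set (FreeGroup ℕ)}
    [Finite (verbalSubgroup W G)] (hW : verbalSubgroup W G ≠ ⊥) {m n : ℕ} (hmn : m ≠ n) :
    Nat.card (verbalSubgroup W (Fin m → G)) ≠ Nat.card (verbalSubgroup W (Fin n → G)) := by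
  rw [Nat.card_congr (verbalSubgroupPiEquiv (Fin m) G W),
    Nat.card_congr (verbalSubgroupPiEquiv (Fin n) G W), Nat.card_fun, Nat.card_fun, Nat.card_fin,
    Nat.card_fin]
  have : 1 < Nat.card (verbalSubgroup W G) := (Subgroup.one_lt_card_iff_ne_bot _).2 hW
  exact (Nat.pow_right_injective this).ne hmn

theorem component_pi_ne {G : Type u} [Group G] [Group.FG G] [Group.IsNilpotent G]
    {W : Set (FreeGroup ℕ)} [Finite (verbalSubgroup W G)] (hW : verbalSubgroup W G ≠ ⊥) {m n : ℕ}
    (hmn : m ≠ n) : component (Fin m → G) ≠ component (Fin n → G) := by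
  intro h
  exact card_verbalSubgroup_ne hW hmn.symm
    (congrArg ENat.toNat ((invariants_of_component_eq h).2.2 W))

/-- The classes generating the variety of a nilpotent group form a union of components. -/
theorem generators_eq_iUnion_supp (G : Type u) [Group G] [Group.FG G] [Group.IsNilpotent G] :
    generators.{u} (_root_.identities G) =
      ⋃ c ∈ graph.connectedComponentMk '' generators.{u} (_root_.identities G), c.supp := by
  refine subset_antisymm (fun a ha => ?_) ?_
  · exact Set.mem_biUnion (Set.mem_image_of_mem _ ha) rfl
  · refine Set.iUnion₂_subset ?_
    rintro _ ⟨b, hb, rfl⟩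
    obtain ⟨B, _, _, rfl⟩ := exists_eq_of b
    have hb : _root_.identities B = _root_.identities G := hb
    have : Group.IsNilpotent B := isNilpotent_of_identities_eq hb
    rw [← hb]
    exact supp_component_subset B

end FGGroupClass

theorem mainTheorem7 (G : Type u) [Group G] [Group.FG G] [Group.IsNilpotent G] :
    ((FGGroupClass.component G).supp = FGGroupClass.generators (identities G) ↔
      identities (G ⧸ torsionSubgroup G) = identities G) ∧
    (identities (G ⧸ torsionSubgroup G) ≠ identities G →
      (∃ C : Set FGGroupClass.graph.{u}.ConnectedComponent,
        C.Infinite ∧ FGGroupClass.generators (identities G) = ⋃ c ∈ C, c.supp) ∧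
      ∃ W : Set (FreeGroup ℕ),
        Finite (verbalSubgroup W G) ∧ verbalSubgroup W G ≠ ⊥ ∧
        (∀ n : ℕ, 1 ≤ n →
          FGGroupClass.of (Fin n → G) ∈ FGGroupClass.generators (identities G) ∧
          Finite (verbalSubgroup W (Fin n → G)) ∧
          ∀ (H : Type u) [Group H] [Group.FG H],
            FGGroupClass.component H = FGGroupClass.component (Fin n → G) →
              Finite (verbalSubgroup W H) ∧
              Nat.card (verbalSubgroup W H) = Nat.card (verbalSubgroup W (Fin n → G))) ∧
        ∀ m n : ℕ, 1 ≤ m → 1 ≤ n → m ≠ n →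
          Nat.card (verbalSubgroup W (Fin m → G)) ≠ Nat.card (verbalSubgroup W (Fin n → G)) ∧
          FGGroupClass.component (Fin m → G) ≠ FGGroupClass.component (Fin n → G)) := by
  -- The set W is the set of identities of the torsion-free quotient; its values in `G` are torsion.
  have hWfin : Finite (verbalSubgroup (identities (G ⧸ torsionSubgroup G)) G) := by
    have := finite_torsionSubgroup G
    exact Finite.Set.subset (torsionSubgroup G : Set G) (verbalSubgroup_identities_quotient_le _)
  have hWbot : identities (G ⧸ torsionSubgroup G) ≠ identities G →
      verbalSubgroup (identities (G ⧸ torsionSubgroup G)) G ≠ ⊥ := fun h hbot =>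
    h ((verbalSubgroup_eq_bot_iff.1 hbot).antisymm (identities_subset_quotient _))
  refine ⟨⟨fun h => ?_, fun h => ?_⟩, fun h => ⟨?_, ?_⟩⟩
  · by_contra hne
    have hmem : ∀ n : ℕ, 1 ≤ n →
        FGGroupClass.component (Fin n → G) = FGGroupClass.component G := fun n hn => by
      have h1 := FGGroupClass.mem_generators_pi G hn
      rw [← h] at h1
      exact h1
    exact FGGroupClass.component_pi_ne (hWbot hne) (by decide : 1 ≠ 2)
      ((hmem 1 le_rfl).trans (hmem 2 one_le_two).symm)
  · exact (FGGroupClass.supp_component_subset G).antisymm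
      (FGGroupClass.generators_subset_supp_component G h)
  · refine ⟨_, ?_, FGGroupClass.generators_eq_iUnion_supp G⟩
    -- The shift to `n + 1` omits the zeroth power, which is trivial and need not generate the
    -- variety.
    refine Set.infinite_of_injective_forall_mem
      (f := fun n : ℕ => FGGroupClass.component (Fin (n + 1) → G)) (fun m n hmn => ?_) fun n =>
        ⟨_, FGGroupClass.mem_generators_pi G (Nat.le_add_left 1 n), rfl⟩
    by_contra hne
    exact FGGroupClass.component_pi_ne (hWbot h) (fun he => hne (Nat.succ_injective he)) hmn
  · have hfin : ∀ n : ℕ,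
        Finite (verbalSubgroup (identities (G ⧸ torsionSubgroup G)) (Fin n → G)) := fun n =>
      Finite.of_equiv _ (verbalSubgroupPiEquiv (Fin n) G _).symm
    refine ⟨identities (G ⧸ torsionSubgroup G), hWfin, hWbot h, fun n hn =>
      ⟨FGGroupClass.mem_generators_pi G hn, hfin n, fun H _ _ hH => ?_⟩, fun m n _ _ hmn =>
      ⟨FGGroupClass.card_verbalSubgroup_ne (hWbot h) hmn,
        FGGroupClass.component_pi_ne (hWbot h) hmn⟩⟩
    -- Equality in `ℕ∞` transfers finiteness as well, which `Nat.card` alone would not.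
    have hcard := (FGGroupClass.invariants_of_component_eq hH.symm).2.2
      (identities (G ⧸ torsionSubgroup G))
    refine ⟨?_, congrArg ENat.toNat hcard⟩
    have := hfin n
    exact (Set.encard_ne_top_iff.1 (hcard ▸ Set.encard_ne_top_iff.2 (Set.toFinite _))).to_subtype
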